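/- **Theorem 3.9 (Pólya–Szegő inequality for Besov polar projection bodies).** Let $n\ge 1$, $s\in(0,1)$ and $p,q\in[1,\infty)$. Let $f:\mathbb{R}^n\to\mathbb{R}$ be a measurable function such that $\{|f|\ge t\}$ has finite Lebesgue measure for every $t>0$. Let $f^\star(x)=\int_0^\infty \mathbf 1_{\{|f|\ge t\}^\star}(x)\,dt$ be its Schwarz symmetral, where for a set $E\subset\mathbb{R}^n$ of finite measure $|E|$, $E^\star$ is the closed Euclidean ball centred at the origin with $|E^\star|=|E|$ (and $E^\star=\emptyset$ if $|E|=0$). For a measurable function $g:\mathbb{R}^n\to\mathbb{R}$, the Besov polar projection body $\Pi^{*,s}_{p,q}g$ is the star-shaped set $\{\xi\in\mathbb{R}^n:\|\xi\|_{\Pi^{*,s}_{p,q}g}\le 1\}$ with gauge function $$\|\xi\|_{\Pi^{*,s}_{p,q}g}^{sq}=\int_0^\infty t^{-sq}\,\|g(\cdot+t\xi)-g\|_{L^p(\mathbb{R}^n)}^q\,\frac{dt}{t}\in[0,\infty],\qquad \xi\in\mathbb{R}^n .$$ Then $$\big|\Pi^{*,s}_{p,q}f^\star\big|^{-\frac{sq}{n}}\le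 4^q\,(2^n+1)^{\max\{\frac qp,1\}}\,\big|\Pi^{*,s}_{p,q}f\big|^{-\frac{sq}{n}},$$ where $|\cdot|$ is Lebesgue measure, $0^{-sq/n}=\infty$ and $\infty^{-sq/n}=0$. If $p=q$, the constant $4^p(2^n+1)$ can be replaced by $1$, that is, $$\big|\Pi^{*,s}_{p,p}f^\star\big|^{-\frac{sp}{n}}\le \big|\Pi^{*,s}_{p,p}f\big|^{-\frac{sp}{n}} .$$ -/

import Mathlib

open MeasureTheory Set Metric
open scoped ENNReal Pointwise

/-- The Schwarz symmetral of a set `A` of finite Lebesgue measure in `ℝⁿ`, `n ≥ 1`: the closed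
Euclidean ball centred at the origin that has the same measure as `A`; its radius `r` is given by
`|B(0, 1)| rⁿ = |A|`. The ball of measure zero is the empty set (with `{0}` instead, a layer-cake
integral would be infinite at the origin even for bounded functions). -/
noncomputable def schwarzSet {n : ℕ} (A : Set (EuclideanSpace ℝ (Fin n))) :
    Set (EuclideanSpace ℝ (Fin n)) :=
  {x | volume A ≠ 0 ∧
    x ∈ closedBall (0 : EuclideanSpace ℝ (Fin n))
      (((volume A).toReal / (volume (ball (0 : EuclideanSpace ℝ (Fin n)) 1)).toReal) ^
        (1 / (n : ℝ)))}

/-- The Schwarz symmetral `f⋆(x) = ∫₀^∞ 1_{{|f| ≥ t}⋆}(x) dt` of a function all of whose level sets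
`{|f| ≥ t}`, `t > 0`, have finite measure. The integral is finite for every `x ≠ 0`. At the single
point `x = 0` it is the essential supremum of `|f|`, and the value `0` is used there if this is
infinite. -/
noncomputable def schwarzSymm {n : ℕ} (f : EuclideanSpace ℝ (Fin n) → ℝ) :
    EuclideanSpace ℝ (Fin n) → ℝ := fun x =>
  (∫⁻ t in Ioi (0 : ℝ),
    (schwarzSet {y | t ≤ |f y|}).indicator (fun _ => (1 : ℝ≥0∞)) x).toReal

/-- The function `ξ ↦ (∫₀^∞ t^{-sq} ‖f(· + tξ) - f‖_{L^p}^q dt/t)^{1/(sq)}` with values in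
`[0, ∞]`. -/
noncomputable def besovGauge {n : ℕ} (s p q : ℝ) (f : EuclideanSpace ℝ (Fin n) → ℝ)
    (ξ : EuclideanSpace ℝ (Fin n)) : ℝ≥0∞ :=
  (∫⁻ t in Ioi (0 : ℝ),
    ENNReal.ofReal (t ^ (-(s * q))) *
      eLpNorm (fun x => f (x + t • ξ) - f x) (ENNReal.ofReal p) volume ^ q *
      ENNReal.ofReal t⁻¹) ^ (1 / (s * q))

/-- The Besov polar projection body `Π^{*,s}_{p,q} f`: the star-shaped set whose gauge function is
`besovGauge s p q f`, see `starConvex_besovBody` and `starGauge_besovBody`. -/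
noncomputable def besovBody {n : ℕ} (s p q : ℝ) (f : EuclideanSpace ℝ (Fin n) → ℝ) :
    Set (EuclideanSpace ℝ (Fin n)) :=
  {ξ | besovGauge s p q f ξ ≤ 1}

/-- The gauge function `x ↦ inf {l > 0 : x ∈ l K}` of a star-shaped set, with `inf ∅ = ∞`. -/
noncomputable def starGauge {n : ℕ} (K : Set (EuclideanSpace ℝ (Fin n)))
    (x : EuclideanSpace ℝ (Fin n)) : ℝ≥0∞ :=
  ⨅ (l : ℝ) (_ : 0 < l ∧ x ∈ l • K), ENNReal.ofReal l

theorem volume_schwarzSet {n : ℕ} (hn : 1 ≤ n) (A : Set (EuclideanSpace ℝ (Fin n)))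
    (hA : volume A ≠ ∞) : volume (schwarzSet A) = volume A := by
  by_cases h0 : volume A = 0
  · simp [schwarzSet, h0]
  · have hb0 : volume (ball (0 : EuclideanSpace ℝ (Fin n)) 1) ≠ 0 :=
      (measure_ball_pos _ _ one_pos).ne'
    have hb1 : volume (ball (0 : EuclideanSpace ℝ (Fin n)) 1) ≠ ∞ := measure_ball_lt_top.ne
    have hq : 0 ≤ (volume A).toReal / (volume (ball (0 : EuclideanSpace ℝ (Fin n)) 1)).toReal :=
      by positivity
    have hset : schwarzSet A = closedBall (0 : EuclideanSpace ℝ (Fin n))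
        (((volume A).toReal / (volume (ball (0 : EuclideanSpace ℝ (Fin n)) 1)).toReal) ^
          (1 / (n : ℝ))) := by
      ext x; simp [schwarzSet, h0]
    rw [hset, Measure.addHaar_closedBall _ _ (by positivity), finrank_euclideanSpace_fin,
      ← Real.rpow_natCast, ← Real.rpow_mul hq,
      one_div_mul_cancel (by positivity), Real.rpow_one, ENNReal.ofReal_div_of_pos
        (ENNReal.toReal_pos hb0 hb1), ENNReal.ofReal_toReal hA, ENNReal.ofReal_toReal hb1,
      ENNReal.div_mul_cancel hb0 hb1]

theorem besovGauge_smul {n : ℕ} {s p q : ℝ} (hs : 0 < s) (hq : 0 < q)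
    (f : EuclideanSpace ℝ (Fin n) → ℝ) (ξ : EuclideanSpace ℝ (Fin n)) {l : ℝ} (hl : 0 < l) :
    besovGauge s p q f (l • ξ) = ENNReal.ofReal l * besovGauge s p q f ξ := by
  have hsq : 0 < s * q := mul_pos hs hq
  set G : ℝ → ℝ≥0∞ := fun t => (Ioi (0 : ℝ)).indicator (fun t =>
    ENNReal.ofReal (t ^ (-(s * q))) *
      eLpNorm (fun x => f (x + t • ξ) - f x) (ENNReal.ofReal p) volume ^ q *
      ENNReal.ofReal t⁻¹) t with hG
  have key : ∫⁻ t in Ioi (0 : ℝ),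
      ENNReal.ofReal (t ^ (-(s * q))) *
        eLpNorm (fun x => f (x + t • l • ξ) - f x) (ENNReal.ofReal p) volume ^ q *
        ENNReal.ofReal t⁻¹ = ENNReal.ofReal (l ^ (s * q)) * ∫⁻ t, G t := by
    have h1 : ∫⁻ t, G (t * l) = ENNReal.ofReal l⁻¹ * ∫⁻ t, G t := by
      have hemb : MeasurableEmbedding (fun t : ℝ => t * l) :=
        (Homeomorph.mulRight₀ l hl.ne').measurableEmbedding
      have := hemb.lintegral_map (μ := volume) G
      rw [Real.map_volume_mul_right hl.ne', lintegral_smul_measure, abs_of_pos (by positivity)]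
        at this
      exact this.symm
    have h2 : ENNReal.ofReal (l ^ (s * q)) * ∫⁻ t, G t
        = ENNReal.ofReal (l ^ (s * q + 1)) * ∫⁻ t, G (t * l) := by
      rw [h1, ← mul_assoc, ← ENNReal.ofReal_mul (by positivity), Real.rpow_add hl, Real.rpow_one,
        mul_inv_cancel_right₀ hl.ne']
    rw [h2, ← lintegral_const_mul' _ _ ENNReal.ofReal_ne_top,
      ← lintegral_indicator measurableSet_Ioi]
    congr 1
    ext t
    by_cases ht : 0 < t
    · have htl : 0 < t * l := mul_pos ht hl
      simp only [hG, indicator_of_mem (mem_Ioi.2 ht), indicator_of_mem (mem_Ioi.2 htl), mul_smul]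
      set X := eLpNorm (fun x => f (x + t • l • ξ) - f x) (ENNReal.ofReal p) volume ^ q
      have e : t ^ (-(s * q)) * t⁻¹
          = l ^ (s * q + 1) * ((t * l) ^ (-(s * q)) * (t * l)⁻¹) := by
        rw [Real.mul_rpow ht.le hl.le, Real.rpow_add hl, Real.rpow_one, Real.rpow_neg hl.le]
        have : l ^ (s * q) ≠ 0 := (Real.rpow_pos_of_pos hl _).ne'
        field_simp
      rw [mul_right_comm, ← ENNReal.ofReal_mul (by positivity), e,
        mul_right_comm (ENNReal.ofReal ((t * l) ^ _)),
        ← ENNReal.ofReal_mul (p := (t * l) ^ (-(s * q))) (by positivity),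
        ENNReal.ofReal_mul (p := l ^ (s * q + 1)) (by positivity), mul_assoc]
    · have htl : ¬ 0 < t * l := fun h => ht (pos_of_mul_pos_left h hl.le)
      simp [hG, ht, htl]
  unfold besovGauge
  rw [key, hG, lintegral_indicator measurableSet_Ioi,
    ENNReal.mul_rpow_of_nonneg _ _ (by positivity),
    ENNReal.ofReal_rpow_of_pos (by positivity), ← Real.rpow_mul hl.le,
    mul_one_div_cancel hsq.ne', Real.rpow_one]

theorem besovGauge_zero {n : ℕ} {s p q : ℝ} (hs : 0 < s) (hq : 0 < q)
    (f : EuclideanSpace ℝ (Fin n) → ℝ) : besovGauge s p q f 0 = 0 := by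
  have h : (fun _ : EuclideanSpace ℝ (Fin n) => (0 : ℝ)) = 0 := rfl
  simp [besovGauge, h, hq, hs]

theorem starConvex_besovBody {n : ℕ} {s p q : ℝ} (hs : 0 < s) (hq : 0 < q)
    (f : EuclideanSpace ℝ (Fin n) → ℝ) : StarConvex ℝ 0 (besovBody s p q f) := by
  rw [starConvex_zero_iff]
  intro x hx a ha0 ha1
  rcases ha0.eq_or_lt with rfl | ha
  · simp [besovBody, besovGauge_zero hs hq]
  · simp only [besovBody, mem_ofPred_eq, besovGauge_smul hs hq f x ha] at hx ⊢
    exact mul_le_one' (by simpa using ha1) hx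

theorem starGauge_besovBody {n : ℕ} {s p q : ℝ} (hs : 0 < s) (hq : 0 < q)
    (f : EuclideanSpace ℝ (Fin n) → ℝ) (x : EuclideanSpace ℝ (Fin n)) :
    starGauge (besovBody s p q f) x = besovGauge s p q f x := by
  have hmem : ∀ l : ℝ, 0 < l →
      (x ∈ l • besovBody s p q f ↔ besovGauge s p q f x ≤ ENNReal.ofReal l) := by
    intro l hl
    rw [mem_smul_set_iff_inv_smul_mem₀ hl.ne', besovBody, mem_ofPred_eq,
      besovGauge_smul hs hq f x (inv_pos.2 hl), ENNReal.ofReal_inv_of_pos hl, mul_comm,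
      ← div_eq_mul_inv, ENNReal.div_le_iff (by simpa using hl) ENNReal.ofReal_ne_top, one_mul]
  apply le_antisymm
  · refine le_of_forall_gt fun c hc => ?_
    obtain ⟨d, hd1, hd2⟩ := exists_between hc
    have hdt : d ≠ ∞ := hd2.ne_top
    have hd0 : 0 < d.toReal := ENNReal.toReal_pos (pos_of_gt hd1).ne' hdt
    refine lt_of_le_of_lt (iInf₂_le d.toReal ⟨hd0, ?_⟩) ?_
    · rwa [ENNReal.ofReal_toReal hdt]
    · rw [hmem _ hd0, ENNReal.ofReal_toReal hdt]; exact hd1.le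
  · exact le_iInf₂ fun l hl => (hmem l hl.1).1 hl.2

/-!
For `p = q` the theorem rests on the Riesz rearrangement inequality. Write
`F_f(ξ) = ∫ |f(x + ξ) - f(x)|^p dx` (`translateEnergy`). The function `u ↦ (u₊)^p` is a mixture of
the functions `u ↦ (u - r)₊` with `r ≥ 0`, so `F_f(ξ)` is an integral of measures of the form
`|{f > τ + r} \ ({f > τ} - ξ)|`. Integrating over `ξ ∈ C` and applying Riesz to the three sets
`{f > τ + r}`, `{f > τ}`, `C` gives `∫_{C⋆} F_{f⋆} ≤ ∫_C F_f` for *every* set `C` of finite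
measure (`IsBallRearrangement.lintegral_translateEnergy_le`). Applied to the dilates `tC` and
integrated in `t`, this gives `∫_{C⋆} ‖·‖_{Π f⋆}^{sp} ≤ ∫_C ‖·‖_{Π f}^{sp}`. For `C` the
intersection of `Π f` with a ball, star-shapedness bounds the right-hand side by the integral of the
homogeneous gauge of `C⋆`; since the gauge of `Π f⋆` is a multiple of the Euclidean norm,
`C⋆ ⊆ Π f⋆`.

For general `p, q`, the fact that `C` is arbitrary is used a second time. As `F_{f⋆}` is a
nondecreasing function of the norm, the inequality for a subset `D ⊆ C` yields
`∫_D F_f(t ·) ≥ a (|D| - |C| / 2)`, where `a` is the value of `F_{f⋆}(t ·)` at half of the radius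
of `C⋆`. For `q ≤ p` take for `D` the part of `C` where `F_f(t ·) < a`, for `q > p` take `D = C`
and use Hölder; in both cases
`∫_C F_f(t ·)^{q/p} ≥ 2^{-max(q/p, 1)} a^{q/p} |C|` (`mul_le_lintegral_rpow`).
Integration in `t` bounds the gauge of `Π f⋆` with the constant `2^{sq} 2^{max(q/p, 1)}`, which is
at most `4^q (2^n + 1)^{max(q/p, 1)}`.

The Riesz inequality `tripleOverlap_le_ball` is proved by Steiner symmetrization. On the line,
cutting `A` and `B` at points that leave measure `t` to the left gives the bound
`t |C| + (|A| - t) (|B| - t)` for the overlap integral, which is attained by centred intervals for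
the best `t`. By Fubini, Steiner symmetrization in any direction does not decrease the overlap. It
brings sets closer to balls at a definite rate: if `X = A \ A⋆` and `Y = A⋆ \ A` lie in the ball of
radius `R`, some translation `z` moves a part of `X` of measure at least `|X| |Y| / |B_{2R}|` into
`Y`, and symmetrizing `A` in the direction of `z` gains at least this measure for `A ∩ A⋆`. Hence
finitely many symmetrizations bring three sets as close to their balls as desired.
-/

/-! ### The overlap integral of three sets and the Riesz inequality on the line -/

/-- The functional `∬ 1_A(x) 1_B(x + z) 1_C(z) dx dz` of the Riesz rearrangement inequality, written
as the integral over `z ∈ C` of the measure of `A ∩ (B - z)`. -/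
noncomputable def tripleOverlap {G : Type*} [Add G] [MeasurableSpace G] (μ : Measure G)
    (A B C : Set G) : ℝ≥0∞ :=
  ∫⁻ z in C, μ (A ∩ (fun x => x + z) ⁻¹' B) ∂μ

section group

variable {G : Type*} [AddCommGroup G] [MeasurableSpace G] [MeasurableAdd₂ G]

theorem measurable_measure_inter_translate (μ : Measure G) [SFinite μ] {A B : Set G}
    (hA : MeasurableSet A) (hB : MeasurableSet B) :
    Measurable fun z => μ (A ∩ (fun x => x + z) ⁻¹' B) := by
  have hS : MeasurableSet {q : G × G | q.2 ∈ A ∧ q.2 + q.1 ∈ B} :=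
    (measurable_snd hA).inter ((measurable_snd.add measurable_fst) hB)
  exact measurable_measure_prodMk_left hS

theorem lintegral_measure_inter_translate (μ : Measure G) [SFinite μ] [μ.IsAddLeftInvariant]
    {A B : Set G} (hA : MeasurableSet A) (hB : MeasurableSet B) :
    ∫⁻ z, μ (A ∩ (fun x => x + z) ⁻¹' B) ∂μ = μ A * μ B := by
  have hS : MeasurableSet {q : G × G | q.2 ∈ A ∧ q.2 + q.1 ∈ B} :=
    (measurable_snd hA).inter ((measurable_snd.add measurable_fst) hB)
  have h1 := Measure.prod_apply (μ := μ) (ν := μ) hS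
  rw [Measure.prod_apply_symm hS] at h1
  have h2 : ∀ y, μ ((fun x => (x, y)) ⁻¹' {q : G × G | q.2 ∈ A ∧ q.2 + q.1 ∈ B})
      = A.indicator (fun _ => μ B) y := by
    intro y
    by_cases hy : y ∈ A
    · simp only [preimage_ofPred_eq, hy, true_and, indicator_of_mem]
      exact measure_preimage_add μ y B
    · simp [hy]
  simp_rw [h2] at h1
  rw [lintegral_indicator hA, setLIntegral_const] at h1
  rw [mul_comm, h1]
  rfl

end group

/-- A bounded set can be cut at a point so that the part to the left has a prescribed measure: the
measure of `A ∩ (-∞, α]` is continuous in `α`. -/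
theorem exists_measure_inter_Iic_eq {A : Set ℝ} (hb : Bornology.IsBounded A)
    {t : ℝ} (h0 : 0 ≤ t) (ht : ENNReal.ofReal t ≤ volume A) :
    ∃ α, volume (A ∩ Iic α) = ENNReal.ofReal t := by
  obtain ⟨R, hR⟩ := hb.subset_closedBall 0
  rw [Real.closedBall_eq_Icc] at hR
  have hfin : ∀ α, volume (A ∩ Iic α) ≠ ∞ := fun α =>
    ((measure_mono inter_subset_left).trans_lt hb.measure_lt_top).ne
  have hle : ∀ x y, x ≤ y → (volume (A ∩ Iic y)).toReal ≤
      (volume (A ∩ Iic x)).toReal + (y - x) := by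
    intro x y hxy
    have : volume (A ∩ Iic y) ≤ volume (A ∩ Iic x) + ENNReal.ofReal (y - x) := by
      rw [← Real.volume_Ioc]
      refine (measure_mono ?_).trans (measure_union_le _ _)
      rintro u ⟨hu, huy⟩
      rcases le_or_gt u x with h | h
      · exact Or.inl ⟨hu, h⟩
      · exact Or.inr ⟨h, huy⟩
    have := ENNReal.toReal_mono (by finiteness [hfin x]) this
    rwa [ENNReal.toReal_add (hfin x) ENNReal.ofReal_ne_top,
      ENNReal.toReal_ofReal (by linarith)] at this
  have hmono : Monotone fun α => (volume (A ∩ Iic α)).toReal := fun x y hxy =>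
    ENNReal.toReal_mono (hfin y) (measure_mono (inter_subset_inter_right _ (Iic_subset_Iic.2 hxy)))
  have hcont : Continuous fun α => (volume (A ∩ Iic α)).toReal := by
    refine (LipschitzWith.of_le_add fun x y => ?_).continuous
    rcases le_total x y with h | h
    · exact (hmono h).trans (le_add_of_nonneg_right dist_nonneg)
    · have := hle y x h
      rwa [Real.dist_eq, abs_of_nonneg (by linarith)]
  have h1 : (volume (A ∩ Iic (-|R| - 1))).toReal = 0 := by
    have : A ∩ Iic (-|R| - 1) = ∅ := by
      ext u
      simp only [mem_inter_iff, mem_Iic, mem_empty_iff_false, iff_false, not_and]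
      intro hu hu'
      have := (hR hu).1
      have := le_abs_self R
      linarith
    simp [this]
  have h2 : A ∩ Iic |R| = A := inter_eq_left.2 fun u hu => by
    have := (hR hu).2
    have := le_abs_self R
    simp only [mem_Iic]; linarith
  have h3 := intermediate_value_Icc (a := -|R| - 1) (b := |R|)
    (by have := abs_nonneg R; linarith) hcont.continuousOn
  simp only [h1, h2] at h3
  obtain ⟨α, -, hα⟩ := h3 ⟨h0, by
    rw [← ENNReal.toReal_ofReal h0]; exact ENNReal.toReal_mono hb.measure_lt_top.ne ht⟩
  exact ⟨α, by rw [← hα, ENNReal.ofReal_toReal (hfin α)]⟩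

/-- Upper bound for the overlap integral on the line. Let `A₂` and `B₁` be the left parts of `A` and
`B` of measure `t`. The pairs outside `(A \ A₂) × (B \ B₁)` contribute at most `t` for each shift,
the pairs in `(A \ A₂) × (B \ B₁)` contribute at most the product of the measures after integration
over all shifts. -/
theorem tripleOverlap_real_le {A B C : Set ℝ} (hA : MeasurableSet A) (hB : MeasurableSet B)
    (hAb : Bornology.IsBounded A) (hBb : Bornology.IsBounded B)
    {t : ℝ} (h0 : 0 ≤ t) (htA : ENNReal.ofReal t ≤ volume A) (htB : ENNReal.ofReal t ≤ volume B) :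
    tripleOverlap volume A B C ≤ ENNReal.ofReal t * volume C +
      (volume A - ENNReal.ofReal t) * (volume B - ENNReal.ofReal t) := by
  obtain ⟨α, hα⟩ := exists_measure_inter_Iic_eq hAb h0 htA
  obtain ⟨β, hβ⟩ := exists_measure_inter_Iic_eq hBb h0 htB
  set A₂ := A ∩ Iic α with hA₂
  set B₁ := B ∩ Iic β with hB₁
  have mA₂ : MeasurableSet A₂ := hA.inter measurableSet_Iic
  have mB₁ : MeasurableSet B₁ := hB.inter measurableSet_Iic
  have key : ∀ z : ℝ, volume (A ∩ (fun x => x + z) ⁻¹' B) ≤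
      ENNReal.ofReal t + volume ((A \ A₂) ∩ (fun x => x + z) ⁻¹' (B \ B₁)) := by
    intro z
    have hsub : A ∩ (fun x => x + z) ⁻¹' B ⊆
        ((A ∩ (fun x => x + z) ⁻¹' B₁) ∪ (A₂ ∩ (fun x => x + z) ⁻¹' (B \ B₁))) ∪
          ((A \ A₂) ∩ (fun x => x + z) ⁻¹' (B \ B₁)) := by
      intro x hx
      simp only [mem_union, mem_inter_iff, mem_preimage, mem_sdiff] at hx ⊢
      tauto
    refine (measure_mono hsub).trans ((measure_union_le _ _).trans ?_)
    gcongr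
    -- Either all relevant pairs have first component in `A₂`, or all have second one in `B₁`.
    rcases le_or_gt (β - z) α with h | h
    · rw [← hα]
      refine measure_mono (union_subset ?_ inter_subset_left)
      rintro x ⟨hx, -, hx'⟩
      simp only [mem_Iic] at hx'
      exact ⟨hx, show x ≤ α by linarith⟩
    · rw [← hβ, ← measure_preimage_add_right volume z B₁]
      refine measure_mono (union_subset inter_subset_right ?_)
      rintro x ⟨⟨hx, hx1⟩, hx2, hx3⟩
      simp only [mem_Iic] at hx1
      exact absurd ⟨hx2, show x + z ≤ β by linarith⟩ hx3
  calc tripleOverlap volume A B C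
      ≤ ∫⁻ z in C, (ENNReal.ofReal t + volume ((A \ A₂) ∩ (fun x => x + z) ⁻¹' (B \ B₁))) :=
        lintegral_mono fun z => key z
    _ = ENNReal.ofReal t * volume C +
        ∫⁻ z in C, volume ((A \ A₂) ∩ (fun x => x + z) ⁻¹' (B \ B₁)) := by
        rw [lintegral_add_left measurable_const, setLIntegral_const]
    _ ≤ ENNReal.ofReal t * volume C + volume (A \ A₂) * volume (B \ B₁) := by
        gcongr
        rw [← lintegral_measure_inter_translate volume (hA.diff mA₂) (hB.diff mB₁)]
        exact setLIntegral_le_lintegral _ _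
    _ = _ := by
        rw [measure_sdiff inter_subset_left mA₂.nullMeasurableSet (by rw [hα]; finiteness),
          measure_sdiff inter_subset_left mB₁.nullMeasurableSet (by rw [hβ]; finiteness), hα, hβ]

/-- For centred intervals of lengths `a`, `b`, `c` the bound of `tripleOverlap_real_le` is attained
when `t` is the point of `[0, min a b]` closest to `(a + b - c) / 2`. -/
theorem le_tripleOverlap_ball_real {a b c t : ℝ}
    (h0 : 0 ≤ t) (hta : t ≤ a) (htb : t ≤ b) (h1 : t = 0 ∨ t ≤ (a + b - c) / 2)
    (h2 : t = a ∨ t = b ∨ (a + b - c) / 2 ≤ t) :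
    ENNReal.ofReal t * ENNReal.ofReal c + ENNReal.ofReal (a - t) * ENNReal.ofReal (b - t) ≤
      tripleOverlap volume (ball (0 : ℝ) (a / 2)) (ball 0 (b / 2)) (ball 0 (c / 2)) := by
  set A' := Ioo (-(a / 2) + t) (a / 2)
  set B' := Ioo (-(b / 2) + t) (b / 2)
  have key : ∀ z ∈ ball (0 : ℝ) (c / 2),
      ENNReal.ofReal t + volume (A' ∩ (fun x => x + z) ⁻¹' B') ≤
        volume (ball (0 : ℝ) (a / 2) ∩ (fun x => x + z) ⁻¹' ball 0 (b / 2)) := by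
    intro z hz
    rw [Real.ball_eq_Ioo] at hz
    simp only [mem_Ioo] at hz
    have mA'B' : MeasurableSet (A' ∩ (fun x => x + z) ⁻¹' B') :=
      measurableSet_Ioo.inter ((measurable_add_const z) measurableSet_Ioo)
    have hsub : A' ∩ (fun x => x + z) ⁻¹' B' ⊆
        ball (0 : ℝ) (a / 2) ∩ (fun x => x + z) ⁻¹' ball 0 (b / 2) := by
      simp only [Real.ball_eq_Ioo]
      rintro x ⟨⟨hx1, hx2⟩, hx3, hx4⟩
      simp only [mem_inter_iff, mem_Ioo, mem_preimage]
      refine ⟨⟨?_, ?_⟩, ?_, ?_⟩ <;> linarith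
    -- Besides the shifted right parts, the overlap contains an interval of length `t`: the left
    -- part of the first interval if `z` is large, that of the shifted second one otherwise.
    rcases h1 with rfl | h1
    · simpa using measure_mono hsub
    rcases le_or_gt ((a - b) / 2) z with hz' | hz'
    · have hv : volume (Ioo (-(a / 2)) (-(a / 2) + t)) = ENNReal.ofReal t := by
        rw [Real.volume_Ioo]; congr 1; ring
      rw [← hv, ← measure_union _ mA'B']
      · refine measure_mono (union_subset ?_ hsub)
        simp only [Real.ball_eq_Ioo]
        rintro x ⟨hx1, hx2⟩
        simp only [mem_inter_iff, mem_Ioo, mem_preimage]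
        refine ⟨⟨?_, ?_⟩, ?_, ?_⟩ <;> linarith
      · rw [Set.disjoint_left]
        rintro x ⟨-, hx⟩ ⟨⟨hx', -⟩, -⟩
        linarith
    · have hv : volume (Ioo (-(b / 2) - z) (-(b / 2) + t - z)) = ENNReal.ofReal t := by
        rw [Real.volume_Ioo]; congr 1; ring
      rw [← hv, ← measure_union _ mA'B']
      · refine measure_mono (union_subset ?_ hsub)
        simp only [Real.ball_eq_Ioo]
        rintro x ⟨hx1, hx2⟩
        simp only [mem_inter_iff, mem_Ioo, mem_preimage]
        refine ⟨⟨?_, ?_⟩, ?_, ?_⟩ <;> linarith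
      · rw [Set.disjoint_left]
        rintro x ⟨-, hx⟩ ⟨-, hx', -⟩
        linarith
  have hfull : ENNReal.ofReal (a - t) * ENNReal.ofReal (b - t) ≤
      ∫⁻ z in ball (0 : ℝ) (c / 2), volume (A' ∩ (fun x => x + z) ⁻¹' B') := by
    have hprod : ENNReal.ofReal (a - t) * ENNReal.ofReal (b - t) =
        ∫⁻ z, volume (A' ∩ (fun x => x + z) ⁻¹' B') := by
      rw [lintegral_measure_inter_translate volume measurableSet_Ioo measurableSet_Ioo,
        Real.volume_Ioo, Real.volume_Ioo]
      congr 2 <;> ring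
    rcases h2 with rfl | rfl | h2
    · simp
    · simp
    rw [hprod, ← lintegral_indicator measurableSet_ball]
    refine lintegral_mono fun z => ?_
    by_cases hz : z ∈ ball (0 : ℝ) (c / 2)
    · simp [hz]
    · have : A' ∩ (fun x => x + z) ⁻¹' B' = ∅ := by
        ext x
        simp only [mem_inter_iff, mem_preimage, mem_empty_iff_false, iff_false, not_and]
        rintro ⟨hx1, hx2⟩ ⟨hx3, hx4⟩
        apply hz
        rw [Real.ball_eq_Ioo]
        constructor <;> linarith
      simp [this]
  calc _ ≤ ENNReal.ofReal t * volume (ball (0 : ℝ) (c / 2)) +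
        ∫⁻ z in ball (0 : ℝ) (c / 2), volume (A' ∩ (fun x => x + z) ⁻¹' B') := by
        rw [Real.volume_ball, mul_div_cancel₀ _ two_ne_zero]
        gcongr
    _ = ∫⁻ z in ball (0 : ℝ) (c / 2),
        (ENNReal.ofReal t + volume (A' ∩ (fun x => x + z) ⁻¹' B')) := by
        rw [lintegral_add_left measurable_const, setLIntegral_const]
    _ ≤ _ := setLIntegral_mono' measurableSet_ball key

/-- The Riesz rearrangement inequality for bounded subsets of the line. -/
theorem tripleOverlap_real_le_ball {A B C : Set ℝ} (hA : MeasurableSet A) (hB : MeasurableSet B)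
    (hAb : Bornology.IsBounded A) (hBb : Bornology.IsBounded B) (hCb : Bornology.IsBounded C) :
    tripleOverlap volume A B C ≤ tripleOverlap volume (ball (0 : ℝ) ((volume A).toReal / 2))
      (ball 0 ((volume B).toReal / 2)) (ball 0 ((volume C).toReal / 2)) := by
  set a := (volume A).toReal with ha
  set b := (volume B).toReal with hb
  set c := (volume C).toReal with hc
  have ha' : volume A = ENNReal.ofReal a := (ENNReal.ofReal_toReal hAb.measure_lt_top.ne).symm
  have hb' : volume B = ENNReal.ofReal b := (ENNReal.ofReal_toReal hBb.measure_lt_top.ne).symm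
  have hc' : volume C = ENNReal.ofReal c := (ENNReal.ofReal_toReal hCb.measure_lt_top.ne).symm
  have a0 : 0 ≤ a := ENNReal.toReal_nonneg
  have b0 : 0 ≤ b := ENNReal.toReal_nonneg
  have c0 : 0 ≤ c := ENNReal.toReal_nonneg
  obtain ⟨t, h0, hta, htb, h1, h2⟩ : ∃ t, 0 ≤ t ∧ t ≤ a ∧ t ≤ b ∧ (t = 0 ∨ t ≤ (a + b - c) / 2) ∧
      (t = a ∨ t = b ∨ (a + b - c) / 2 ≤ t) := by
    rcases le_or_gt ((a + b - c) / 2) 0 with h | h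
    · exact ⟨0, le_rfl, a0, b0, Or.inl rfl, Or.inr (Or.inr h)⟩
    rcases le_total a b with hab | hab
    · rcases le_total ((a + b - c) / 2) a with h' | h'
      · exact ⟨_, h.le, h', h'.trans hab, Or.inr le_rfl, Or.inr (Or.inr le_rfl)⟩
      · exact ⟨a, a0, le_rfl, hab, Or.inr h', Or.inl rfl⟩
    · rcases le_total ((a + b - c) / 2) b with h' | h'
      · exact ⟨_, h.le, h'.trans hab, h', Or.inr le_rfl, Or.inr (Or.inr le_rfl)⟩
      · exact ⟨b, b0, hab, le_rfl, Or.inr h', Or.inr (Or.inl rfl)⟩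
  refine (tripleOverlap_real_le hA hB hAb hBb h0 (ha' ▸ ENNReal.ofReal_le_ofReal hta)
    (hb' ▸ ENNReal.ofReal_le_ofReal htb)).trans (le_trans (le_of_eq ?_)
    (le_tripleOverlap_ball_real h0 hta htb h1 h2))
  rw [ha', hb', hc', ENNReal.ofReal_sub _ h0, ENNReal.ofReal_sub _ h0]

/-! ### Steiner symmetrization in a product with the line -/

section steiner

variable {V : Type*} [AddCommGroup V] [MeasurableSpace V] [MeasurableAdd₂ V]

/-- The intersection of `A` with the horizontal line at height `w`, as a subset of `ℝ`. -/
def horizontalSlice {V : Type*} (A : Set (ℝ × V)) (w : V) : Set ℝ := (fun s => (s, w)) ⁻¹' A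

/-- Steiner symmetrization in the direction of the first factor: each horizontal slice is replaced
by the centred open interval of the same length (by the empty set if its length is `0` or `∞`). -/
def steinerProd {V : Type*} (A : Set (ℝ × V)) : Set (ℝ × V) :=
  {x | x.1 ∈ ball (0 : ℝ) ((volume (horizontalSlice A x.2)).toReal / 2)}

theorem measurableSet_horizontalSlice {V : Type*} [MeasurableSpace V] {A : Set (ℝ × V)}
    (hA : MeasurableSet A) (w : V) : MeasurableSet (horizontalSlice A w) :=
  measurable_prodMk_right hA

theorem measurableSet_steinerProd {V : Type*} [MeasurableSpace V] {A : Set (ℝ × V)}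
    (hA : MeasurableSet A) : MeasurableSet (steinerProd A) := by
  have h : Measurable fun w => volume (horizontalSlice A w) := measurable_measure_prodMk_right hA
  have : steinerProd A = {x | |x.1| < (volume (horizontalSlice A x.2)).toReal / 2} := by
    ext x; simp [steinerProd]
  rw [this]
  exact measurableSet_lt measurable_fst.abs ((h.comp measurable_snd).ennreal_toReal.div_const 2)

theorem horizontalSlice_steinerProd {V : Type*} (A : Set (ℝ × V)) (w : V) :
    horizontalSlice (steinerProd A) w =
      ball (0 : ℝ) ((volume (horizontalSlice A w)).toReal / 2) := rfl

theorem volume_horizontalSlice_steinerProd {V : Type*} {A : Set (ℝ × V)} {w : V}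
    (hb : Bornology.IsBounded (horizontalSlice A w)) :
    volume (horizontalSlice (steinerProd A) w) = volume (horizontalSlice A w) := by
  rw [horizontalSlice_steinerProd, Real.volume_ball, mul_div_cancel₀ _ two_ne_zero,
    ENNReal.ofReal_toReal hb.measure_lt_top.ne]

theorem measure_steinerProd {V : Type*} [MeasurableSpace V] (ν : Measure V) [SFinite ν]
    {A : Set (ℝ × V)} (hA : MeasurableSet A)
    (hb : ∀ w, Bornology.IsBounded (horizontalSlice A w)) :
    (volume.prod ν) (steinerProd A) = (volume.prod ν) A := by
  rw [Measure.prod_apply_symm hA, Measure.prod_apply_symm (measurableSet_steinerProd hA)]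
  exact lintegral_congr fun w => volume_horizontalSlice_steinerProd (hb w)

/-- Fubini: the overlap integral in `ℝ × V` is an integral of overlap integrals of slices. -/
theorem tripleOverlap_prod (ν : Measure V) [SFinite ν] {A B C : Set (ℝ × V)}
    (hA : MeasurableSet A) (hB : MeasurableSet B) (hC : MeasurableSet C) :
    tripleOverlap (volume.prod ν) A B C = ∫⁻ w', ∫⁻ w, tripleOverlap volume (horizontalSlice A w)
      (horizontalSlice B (w + w')) (horizontalSlice C w') ∂ν ∂ν := by
  have hadd : MeasurableAdd₂ (ℝ × V) :=
    ⟨((measurable_fst.comp measurable_fst).add (measurable_fst.comp measurable_snd)).prodMk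
      ((measurable_snd.comp measurable_fst).add (measurable_snd.comp measurable_snd))⟩
  have hm := measurable_measure_inter_translate (volume.prod ν) hA hB
  rw [tripleOverlap, ← lintegral_indicator hC, lintegral_prod_symm _ (hm.indicator hC).aemeasurable]
  refine lintegral_congr fun w' => ?_
  have hS : MeasurableSet {q : (ℝ × V) × ℝ | (q.2, q.1.2) ∈ A ∧ (q.2 + q.1.1, q.1.2 + w') ∈ B} := by
    refine MeasurableSet.inter ?_ ?_
    · exact (measurable_snd.prodMk (measurable_snd.comp measurable_fst)) hA
    · exact ((measurable_snd.add (measurable_fst.comp measurable_fst)).prodMk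
        ((measurable_snd.comp measurable_fst).add_const w')) hB
  have hm2 : Measurable fun q : ℝ × V => volume (horizontalSlice A q.2 ∩
      (fun x => x + q.1) ⁻¹' horizontalSlice B (q.2 + w')) := measurable_measure_prodMk_left hS
  have h1 : ∀ t, C.indicator (fun z => (volume.prod ν) (A ∩ (fun x => x + z) ⁻¹' B)) (t, w') =
      ∫⁻ w, (horizontalSlice C w').indicator (fun t => volume (horizontalSlice A w ∩
        (fun x => x + t) ⁻¹' horizontalSlice B (w + w'))) t ∂ν := by
    intro t
    by_cases h : (t, w') ∈ C
    · have h' : t ∈ horizontalSlice C w' := h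
      simp only [indicator_of_mem h, indicator_of_mem h']
      rw [Measure.prod_apply_symm (hA.inter ((measurable_add_const (t, w')) hB))]
      rfl
    · have h' : t ∉ horizontalSlice C w' := h
      simp [indicator_of_notMem h, indicator_of_notMem h']
  simp_rw [h1]
  rw [lintegral_lintegral_swap]
  · refine lintegral_congr fun w => ?_
    rw [lintegral_indicator (measurableSet_horizontalSlice hC w')]
    rfl
  · exact (hm2.indicator (measurable_fst (measurableSet_horizontalSlice hC w'))).aemeasurable

theorem tripleOverlap_le_steinerProd (ν : Measure V) [SFinite ν] {A B C : Set (ℝ × V)}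
    (hA : MeasurableSet A) (hB : MeasurableSet B) (hC : MeasurableSet C)
    (hAb : ∀ w, Bornology.IsBounded (horizontalSlice A w))
    (hBb : ∀ w, Bornology.IsBounded (horizontalSlice B w))
    (hCb : ∀ w, Bornology.IsBounded (horizontalSlice C w)) :
    tripleOverlap (volume.prod ν) A B C ≤
      tripleOverlap (volume.prod ν) (steinerProd A) (steinerProd B) (steinerProd C) := by
  rw [tripleOverlap_prod ν hA hB hC, tripleOverlap_prod ν (measurableSet_steinerProd hA)
    (measurableSet_steinerProd hB) (measurableSet_steinerProd hC)]
  refine lintegral_mono fun w' => lintegral_mono fun w => ?_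
  exact tripleOverlap_real_le_ball (measurableSet_horizontalSlice hA _)
    (measurableSet_horizontalSlice hB _) (hAb _) (hBb _) (hCb _)

/-- If the slices of `K` are centred intervals and a horizontal translation moves `X ⊆ A \ K` into
`K \ A`, then Steiner symmetrization increases the measure of `A ∩ K` by at least the measure of
`X`. On each line, the slice of the symmetrized set and the slice of `K` are nested, so that they
meet in the smaller of the two measures. -/
theorem measure_inter_add_le_steinerProd {V : Type*} [MeasurableSpace V] (ν : Measure V) [SFinite ν]
    {A K X : Set (ℝ × V)} (hA : MeasurableSet A) (hK : MeasurableSet K)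
    (hX : MeasurableSet X) (hb : ∀ w, Bornology.IsBounded (horizontalSlice A w))
    {k : V → ℝ} (hk : ∀ w, horizontalSlice K w = ball 0 (k w)) {h : ℝ}
    (hXA : X ⊆ A \ K) (hXK : ∀ x ∈ X, (x.1 + h, x.2) ∈ K \ A) :
    (volume.prod ν) (A ∩ K) + (volume.prod ν) X ≤ (volume.prod ν) (steinerProd A ∩ K) := by
  rw [Measure.prod_apply_symm (hA.inter hK), Measure.prod_apply_symm hX,
    Measure.prod_apply_symm ((measurableSet_steinerProd hA).inter hK),
    ← lintegral_add_left (measurable_measure_prodMk_right (hA.inter hK))]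
  refine lintegral_mono fun w => ?_
  change volume (horizontalSlice A w ∩ horizontalSlice K w) + volume (horizontalSlice X w) ≤
    volume (horizontalSlice (steinerProd A) w ∩ horizontalSlice K w)
  have mX := measurableSet_horizontalSlice hX w
  have h1 : volume (horizontalSlice A w ∩ horizontalSlice K w) + volume (horizontalSlice X w) ≤
      volume (horizontalSlice A w) := by
    rw [← measure_union _ mX]
    · exact measure_mono (union_subset inter_subset_left fun x hx => (hXA hx).1)
    · exact Set.disjoint_left.2 fun x hx hx' => (hXA hx').2 hx.2
  have h2 : volume (horizontalSlice A w ∩ horizontalSlice K w) + volume (horizontalSlice X w) ≤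
      volume (horizontalSlice K w) := by
    have e : volume (horizontalSlice X w) = volume ((fun x => x + (-h)) ⁻¹' horizontalSlice X w) :=
      (measure_preimage_add_right volume (-h) _).symm
    rw [e, ← measure_union _ ((measurable_add_const (-h)) mX)]
    · refine measure_mono (union_subset inter_subset_right fun x hx => ?_)
      have := (hXK _ hx).1
      simp only [neg_add_cancel_right] at this
      exact this
    · refine Set.disjoint_left.2 fun x hx hx' => ?_
      have := (hXK _ hx').2
      simp only [neg_add_cancel_right] at this
      exact this hx.1
  rw [← volume_horizontalSlice_steinerProd (hb w)] at h1
  rw [horizontalSlice_steinerProd] at h1 ⊢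
  rw [hk] at h1 h2 ⊢
  rcases le_total ((volume (horizontalSlice A w)).toReal / 2) (k w) with h | h
  · rwa [inter_eq_left.2 (ball_subset_ball h)]
  · rwa [inter_eq_right.2 (ball_subset_ball h)]

end steiner

/-! ### Steiner symmetrization of subsets of Euclidean space -/

/-- Orthogonal coordinates on Euclidean space in which the unit vector `v` is the first basis
vector. -/
theorem exists_orthogonal_coordinates {m : ℕ} {v : EuclideanSpace ℝ (Fin (m + 1))} (hv : ‖v‖ = 1) :
    ∃ Q : EuclideanSpace ℝ (Fin (m + 1)) ≃ᵐ ℝ × (Fin m → ℝ),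
      MeasurePreserving Q volume (volume.prod volume) ∧ (∀ x y, Q (x + y) = Q x + Q y) ∧
      (∀ t : ℝ, Q (t • v) = (t, 0)) ∧ ∀ x, ‖x‖ ^ 2 = (Q x).1 ^ 2 + ∑ i, (Q x).2 i ^ 2 := by
  set e : EuclideanSpace ℝ (Fin (m + 1)) := EuclideanSpace.single 0 1 with he
  set U := Submodule.reflection (ℝ ∙ (v - e))ᗮ with hU
  have hUv : U v = e := Submodule.reflection_sub (by simp [hv, he])
  set Q : EuclideanSpace ℝ (Fin (m + 1)) ≃ᵐ ℝ × (Fin m → ℝ) :=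
    (U.toMeasurableEquiv.trans (MeasurableEquiv.toLp 2 (Fin (m + 1) → ℝ)).symm).trans
      (MeasurableEquiv.piFinSuccAbove (fun _ => ℝ) 0) with hQ
  have hQx : ∀ x, Q x = (U x 0, fun i => U x (Fin.succ i)) := fun x => rfl
  refine ⟨Q, ?_, ?_, ?_, ?_⟩
  · exact (volume_preserving_piFinSuccAbove (fun _ : Fin (m + 1) => ℝ) 0).comp
      ((PiLp.volume_preserving_ofLp _).comp U.measurePreserving)
  · intro x y
    simp only [hQx, map_add]
    rfl
  · intro t
    rw [hQx, map_smul, hUv]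
    ext i
    · simp [he]
    · simp [he]
  · intro x
    rw [hQx, ← U.norm_map, EuclideanSpace.norm_sq_eq, Fin.sum_univ_succ]
    simp

theorem tripleOverlap_preimage {G H : Type*} [Add G] [Add H] [MeasurableSpace G]
    [MeasurableSpace H] {μ : Measure G} {ν : Measure H} {Q : G ≃ᵐ H} (hQ : MeasurePreserving Q μ ν)
    (hadd : ∀ x y, Q (x + y) = Q x + Q y) (A B C : Set H) :
    tripleOverlap μ (Q ⁻¹' A) (Q ⁻¹' B) (Q ⁻¹' C) = tripleOverlap ν A B C := by
  rw [tripleOverlap, tripleOverlap, ← hQ.setLIntegral_comp_preimage_emb Q.measurableEmbedding]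
  refine lintegral_congr fun z => ?_
  rw [← hQ.measure_preimage_equiv]
  congr 1
  ext x
  simp [hadd]

/-- The properties of Steiner symmetrization in the direction `v` that the proof of the Riesz
inequality uses, for subsets of the ball of radius `R`. The field `gain` is the quantitative
improvement of `measure_inter_add_le_steinerProd`, for `K` a centred ball. -/
structure IsImprovingSymmetrization {n : ℕ}
    (S : Set (EuclideanSpace ℝ (Fin n)) → Set (EuclideanSpace ℝ (Fin n)))
    (v : EuclideanSpace ℝ (Fin n)) (R : ℝ) : Prop where
  measurableSet : ∀ {A}, MeasurableSet A → MeasurableSet (S A)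
  measure_eq : ∀ {A}, MeasurableSet A → A ⊆ ball 0 R → volume (S A) = volume A
  subset_ball : ∀ {A}, A ⊆ ball 0 R → S A ⊆ ball 0 R
  tripleOverlap_le : ∀ {A B C}, MeasurableSet A → MeasurableSet B → MeasurableSet C →
    A ⊆ ball 0 R → B ⊆ ball 0 R → C ⊆ ball 0 R →
    tripleOverlap volume A B C ≤ tripleOverlap volume (S A) (S B) (S C)
  gain : ∀ {A X} {r h : ℝ}, MeasurableSet A → A ⊆ ball 0 R → MeasurableSet X → X ⊆ A \ ball 0 r →
    (∀ x ∈ X, x + h • v ∈ ball 0 r \ A) →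
    volume (A ∩ ball 0 r) + volume X ≤ volume (S A ∩ ball 0 r)

theorem exists_isImprovingSymmetrization {m : ℕ} {v : EuclideanSpace ℝ (Fin (m + 1))}
    (hv : ‖v‖ = 1) (R : ℝ) : ∃ S, IsImprovingSymmetrization S v R := by
  obtain ⟨Q, hQ, hadd, hQv, hnorm⟩ := exists_orthogonal_coordinates hv
  have hnorm' : ∀ y, ‖Q.symm y‖ ^ 2 = y.1 ^ 2 + ∑ i, y.2 i ^ 2 := fun y => by
    rw [hnorm, Q.apply_symm_apply]
  have hslice : ∀ (r : ℝ) (w : Fin m → ℝ), ∃ k : ℝ,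
      horizontalSlice (Q.symm ⁻¹' ball 0 r) w = ball 0 k := by
    intro r w
    rcases le_or_gt r 0 with hr | hr
    · refine ⟨0, ?_⟩
      simp [ball_eq_empty.2 hr, horizontalSlice]
    refine ⟨√(r ^ 2 - ∑ i, w i ^ 2), ?_⟩
    ext s
    simp only [horizontalSlice, mem_preimage, mem_ball_zero_iff, Real.norm_eq_abs]
    rw [Real.lt_sqrt (abs_nonneg s), sq_abs, lt_sub_iff_add_lt, ← hnorm' (s, w),
      sq_lt_sq₀ (norm_nonneg _) hr.le]
  choose k hk using hslice
  have hpre : ∀ A : Set (EuclideanSpace ℝ (Fin (m + 1))), Q ⁻¹' (Q.symm ⁻¹' A) = A := fun A => by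
    ext x; simp
  have hb : ∀ {A : Set (EuclideanSpace ℝ (Fin (m + 1)))}, A ⊆ ball 0 R → ∀ w,
      horizontalSlice (Q.symm ⁻¹' A) w ⊆ ball 0 (k R w) := fun hA w => by
    rw [← hk]; exact fun s hs => hA hs
  have hb' : ∀ {A : Set (EuclideanSpace ℝ (Fin (m + 1)))}, A ⊆ ball 0 R → ∀ w,
      Bornology.IsBounded (horizontalSlice (Q.symm ⁻¹' A) w) := fun hA w =>
    isBounded_ball.subset (hb hA w)
  have hsymm : ∀ {A : Set (EuclideanSpace ℝ (Fin (m + 1)))}, MeasurableSet A →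
      MeasurableSet (Q.symm ⁻¹' A) := fun hA => Q.symm.measurable hA
  have hvol : ∀ A : Set (ℝ × (Fin m → ℝ)), volume (Q ⁻¹' A) = (volume.prod volume) A :=
    fun A => hQ.measure_preimage_equiv A
  refine ⟨fun A => Q ⁻¹' steinerProd (Q.symm ⁻¹' A), ?_, ?_, ?_, ?_, ?_⟩
  · exact fun hA => Q.measurable (measurableSet_steinerProd (hsymm hA))
  · intro A hA hAR
    rw [hvol, measure_steinerProd volume (hsymm hA) (hb' hAR), ← hvol, hpre]
  · intro A hAR x hx
    have h1 : volume (horizontalSlice (Q.symm ⁻¹' A) (Q x).2) ≤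
        volume (ball (0 : ℝ) (k R (Q x).2)) :=
      measure_mono (hb hAR _)
    have hx' : (Q x).1 ∈ ball (0 : ℝ)
      ((volume (horizontalSlice (Q.symm ⁻¹' A) (Q x).2)).toReal / 2) := hx
    have h2 : (Q x).1 ∈ ball (0 : ℝ) (k R (Q x).2) := by
      have hpos : 0 < (volume (horizontalSlice (Q.symm ⁻¹' A) (Q x).2)).toReal := by
        have := pos_of_mem_ball hx'
        linarith
      rw [Real.volume_ball] at h1
      have h3 := ENNReal.toReal_mono ENNReal.ofReal_ne_top h1
      have hk0 : 0 ≤ 2 * k R (Q x).2 := by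
        by_contra hneg
        rw [ENNReal.ofReal_of_nonpos (not_le.1 hneg).le, ENNReal.toReal_zero] at h3
        linarith
      rw [ENNReal.toReal_ofReal hk0] at h3
      exact ball_subset_ball (by linarith) hx'
    rw [← hk] at h2
    simpa [horizontalSlice] using h2
  · intro A B C hA hB hC hAR hBR hCR
    rw [tripleOverlap_preimage hQ hadd]
    refine le_trans (le_of_eq ?_) (tripleOverlap_le_steinerProd volume (hsymm hA) (hsymm hB)
      (hsymm hC) (hb' hAR) (hb' hBR) (hb' hCR))
    rw [← tripleOverlap_preimage hQ hadd, hpre, hpre, hpre]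
  · intro A X r h hA hAR hX hXA hXK
    have := measure_inter_add_le_steinerProd volume (hsymm hA) (hsymm (measurableSet_ball (x := 0)
      (ε := r))) (hsymm hX) (hb' hAR) (hk r) (h := h) (fun x hx => hXA hx) (fun x hx => ?_)
    · rw [← hvol, ← hvol, ← hvol, preimage_inter, preimage_inter, hpre, hpre, hpre] at this
      exact this
    · have h1 := hXK _ hx
      have h2 : Q.symm (x.1 + h, x.2) = Q.symm x + h • v := by
        rw [Q.symm_apply_eq, hadd, hQv, Q.apply_symm_apply]
        ext <;> simp
      rw [← h2] at h1
      exact h1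

/-! ### The Riesz rearrangement inequality for sets -/

theorem tripleOverlap_mono {G : Type*} [Add G] [MeasurableSpace G] (μ : Measure G)
    {A A' B B' C C' : Set G} (hA : A ⊆ A') (hB : B ⊆ B') (hC : C ⊆ C') :
    tripleOverlap μ A B C ≤ tripleOverlap μ A' B' C' :=
  (lintegral_mono_set hC).trans (lintegral_mono fun _ =>
    measure_mono (inter_subset_inter hA (preimage_mono hB)))

/-- Stability of the overlap integral under changes of small measure of the three sets. -/
theorem tripleOverlap_le_add {G : Type*} [AddCommGroup G] [MeasurableSpace G] [MeasurableAdd₂ G]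
    (μ : Measure G) [SFinite μ] [μ.IsAddLeftInvariant] (A B C : Set G) {A' B' C' : Set G}
    (hC' : MeasurableSet C') :
    tripleOverlap μ A B C ≤ tripleOverlap μ A' B' C' +
      ((μ (A \ A') + μ (B \ B')) * μ C + μ A' * μ (C \ C')) := by
  have h1 : ∀ z, μ (A ∩ (fun x => x + z) ⁻¹' B) ≤
      μ (A' ∩ (fun x => x + z) ⁻¹' B') + (μ (A \ A') + μ (B \ B')) := by
    intro z
    rw [← measure_preimage_add_right μ z (B \ B')]
    refine (measure_mono ?_).trans ((measure_union_le _ _).trans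
      (add_le_add_right (measure_union_le _ _) _))
    intro x hx
    simp only [mem_inter_iff, mem_preimage, mem_union, mem_sdiff] at hx ⊢
    tauto
  calc tripleOverlap μ A B C
      ≤ ∫⁻ z in C, (μ (A' ∩ (fun x => x + z) ⁻¹' B') + (μ (A \ A') + μ (B \ B'))) ∂μ :=
        lintegral_mono h1
    _ = ∫⁻ z in C, μ (A' ∩ (fun x => x + z) ⁻¹' B') ∂μ + (μ (A \ A') + μ (B \ B')) * μ C := by
        rw [lintegral_add_right _ measurable_const, setLIntegral_const]
    _ ≤ (∫⁻ z in C', μ (A' ∩ (fun x => x + z) ⁻¹' B') ∂μ + μ A' * μ (C \ C')) +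
          (μ (A \ A') + μ (B \ B')) * μ C := by
        gcongr
        rw [← lintegral_inter_add_sdiff _ C hC']
        refine add_le_add (lintegral_mono_set inter_subset_right) ?_
        rw [← setLIntegral_const]
        exact lintegral_mono fun z => measure_mono inter_subset_left
    _ = _ := by rw [tripleOverlap, add_assoc, add_comm (μ A' * _)]

/-- Two subsets of a ball of radius `R` overlap, after a suitable translation, at least as much as
on average over all translations by vectors of length less than `2 * R`. -/
theorem exists_measure_mul_le_translate {n : ℕ} {R : ℝ} (hR : 0 < R)
    {X Y : Set (EuclideanSpace ℝ (Fin n))} (hX : MeasurableSet X) (hY : MeasurableSet Y)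
    (hXR : X ⊆ ball 0 R) (hYR : Y ⊆ ball 0 R) :
    ∃ z, volume X * volume Y / volume (ball (0 : EuclideanSpace ℝ (Fin n)) (2 * R)) ≤
      volume (X ∩ (fun x => x + z) ⁻¹' Y) := by
  have h := lintegral_measure_inter_translate volume hX hY
  have hsupp : ∫⁻ z in ball 0 (2 * R), volume (X ∩ (fun x => x + z) ⁻¹' Y) =
      volume X * volume Y := by
    rw [← h, ← lintegral_indicator measurableSet_ball]
    refine lintegral_congr fun z => ?_
    by_cases hz : z ∈ ball (0 : EuclideanSpace ℝ (Fin n)) (2 * R)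
    · simp [hz]
    · have : X ∩ (fun x => x + z) ⁻¹' Y = ∅ := by
        ext x
        simp only [mem_inter_iff, mem_preimage, mem_empty_iff_false, iff_false, not_and]
        intro hx hy
        apply hz
        have h1 := hXR hx
        have h2 := hYR hy
        rw [mem_ball_zero_iff] at *
        have := norm_sub_le (x + z) x
        rw [add_sub_cancel_left] at this
        linarith
      simp [this]
  have hfin : volume X * volume Y ≠ ∞ := ENNReal.mul_ne_top
    ((measure_mono hXR).trans_lt measure_ball_lt_top).ne
    ((measure_mono hYR).trans_lt measure_ball_lt_top).ne
  obtain ⟨z, -, hz⟩ := exists_setLAverage_le (μ := volume)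
    (s := ball (0 : EuclideanSpace ℝ (Fin n)) (2 * R))
    (f := fun z => volume (X ∩ (fun x => x + z) ⁻¹' Y))
    (measure_ball_pos _ _ (by positivity)).ne' measurableSet_ball.nullMeasurableSet
    (by rw [hsupp]; exact hfin)
  exact ⟨z, by rwa [setLAverage_eq, hsupp] at hz⟩

theorem IsImprovingSymmetrization.measure_sdiff_add_le {n : ℕ}
    {S : Set (EuclideanSpace ℝ (Fin n)) → Set (EuclideanSpace ℝ (Fin n))}
    {v : EuclideanSpace ℝ (Fin n)} {R : ℝ} (hS : IsImprovingSymmetrization S v R)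
    {A X : Set (EuclideanSpace ℝ (Fin n))} {r h : ℝ} (hA : MeasurableSet A) (hAR : A ⊆ ball 0 R)
    (hX : MeasurableSet X) (hXA : X ⊆ A \ ball 0 r) (hXK : ∀ x ∈ X, x + h • v ∈ ball 0 r \ A) :
    volume (S A \ ball 0 r) + volume X ≤ volume (A \ ball 0 r) := by
  have h1 := hS.gain hA hAR hX hXA hXK
  have h2 := measure_inter_add_sdiff (μ := volume) A (measurableSet_ball (x := 0) (ε := r))
  have h3 := measure_inter_add_sdiff (μ := volume) (S A) (measurableSet_ball (x := 0) (ε := r))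
  rw [hS.measure_eq hA hAR] at h3
  have hfin : volume (A ∩ ball 0 r) ≠ ∞ :=
    ((measure_mono (inter_subset_left.trans hAR)).trans_lt measure_ball_lt_top).ne
  refine (ENNReal.add_le_add_iff_left hfin).1 ?_
  calc _ = (volume (A ∩ ball 0 r) + volume X) + volume (S A \ ball 0 r) := by
        rw [add_assoc, add_comm (volume X)]
    _ ≤ volume (S A ∩ ball 0 r) + volume (S A \ ball 0 r) := by gcongr
    _ = _ := by rw [h3, h2]

/-- For `A` with centred ball `A⋆` of the same measure, symmetrization in a suitable direction
decreases the measure of `A \ A⋆` by a fixed multiple of its square. The direction is that of a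
translation that moves much of `A \ A⋆` into `A⋆ \ A`. -/
theorem exists_direction_measure_sdiff_add_le {n : ℕ} (hn : 1 ≤ n) {R : ℝ} (hR : 0 < R)
    {A : Set (EuclideanSpace ℝ (Fin n))} {r : ℝ} (hr : r ≤ R) (hA : MeasurableSet A)
    (hAR : A ⊆ ball 0 R) (hAr : volume (ball (0 : EuclideanSpace ℝ (Fin n)) r) = volume A) :
    ∃ v : EuclideanSpace ℝ (Fin n), ‖v‖ = 1 ∧ ∀ S, IsImprovingSymmetrization S v R →
      volume (S A \ ball 0 r) + volume (A \ ball 0 r) * volume (A \ ball 0 r) /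
        volume (ball (0 : EuclideanSpace ℝ (Fin n)) (2 * R)) ≤ volume (A \ ball 0 r) := by
  have mX : MeasurableSet (A \ ball 0 r) := hA.diff measurableSet_ball
  have mY : MeasurableSet (ball 0 r \ A) := measurableSet_ball.diff hA
  have hXY : volume (ball 0 r \ A) = volume (A \ ball 0 r) := by
    have h2 := measure_inter_add_sdiff (μ := volume) A (measurableSet_ball (x := 0) (ε := r))
    have h3 := measure_inter_add_sdiff (μ := volume) (ball 0 r) hA
    have hfin : volume (A ∩ ball 0 r) ≠ ∞ :=
      ((measure_mono (inter_subset_left.trans hAR)).trans_lt measure_ball_lt_top).ne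
    rw [hAr, inter_comm, ← h2] at h3
    exact (ENNReal.add_right_inj hfin).1 h3
  obtain ⟨z, hz⟩ := exists_measure_mul_le_translate hR mX mY (sdiff_subset.trans hAR)
    (sdiff_subset.trans (ball_subset_ball hr))
  rw [hXY] at hz
  have mz : MeasurableSet ((A \ ball 0 r) ∩ (fun x => x + z) ⁻¹' (ball 0 r \ A)) :=
    mX.inter ((measurable_add_const z) mY)
  -- For `z = 0` the two sets are disjoint, and any direction will do.
  rcases eq_or_ne z 0 with rfl | hz0
  · have : Nonempty (Fin n) := ⟨⟨0, hn⟩⟩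
    obtain ⟨v, hv⟩ := exists_norm_eq (EuclideanSpace ℝ (Fin n)) zero_le_one
    refine ⟨v, hv, fun S hS => le_trans (add_le_add_right hz _)
      (hS.measure_sdiff_add_le (h := 0) hA hAR mz inter_subset_left fun x hx => ?_)⟩
    simpa using hx.2
  · refine ⟨‖z‖⁻¹ • z, norm_smul_inv_norm hz0, fun S hS => le_trans (add_le_add_right hz _)
      (hS.measure_sdiff_add_le (h := ‖z‖) hA hAR mz inter_subset_left fun x hx => ?_)⟩
    rw [smul_inv_smul₀ (norm_ne_zero_iff.2 hz0)]
    exact hx.2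

theorem IsImprovingSymmetrization.measure_sdiff_le {n : ℕ}
    {S : Set (EuclideanSpace ℝ (Fin n)) → Set (EuclideanSpace ℝ (Fin n))}
    {v : EuclideanSpace ℝ (Fin n)} {R : ℝ} (hS : IsImprovingSymmetrization S v R)
    {A : Set (EuclideanSpace ℝ (Fin n))} (r : ℝ) (hA : MeasurableSet A) (hAR : A ⊆ ball 0 R) :
    volume (S A \ ball 0 r) ≤ volume (A \ ball 0 r) := by
  simpa using hS.measure_sdiff_add_le (r := r) (h := 0) hA hAR MeasurableSet.empty
    (empty_subset _) (by simp)

/-- `A'`, `B'`, `C'` are measurable subsets of the ball of radius `R` with the measures of `A`, `B`,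
`C` and an overlap integral that is at least as large. -/
structure ReachableTriple {n : ℕ} (R : ℝ) (A B C A' B' C' : Set (EuclideanSpace ℝ (Fin n))) :
    Prop where
  mA : MeasurableSet A'
  mB : MeasurableSet B'
  mC : MeasurableSet C'
  subA : A' ⊆ ball 0 R
  subB : B' ⊆ ball 0 R
  subC : C' ⊆ ball 0 R
  volA : volume A' = volume A
  volB : volume B' = volume B
  volC : volume C' = volume C
  le : tripleOverlap volume A B C ≤ tripleOverlap volume A' B' C'

theorem ReachableTriple.step {n : ℕ} {R : ℝ} {A B C A' B' C' : Set (EuclideanSpace ℝ (Fin n))}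
    (h : ReachableTriple R A B C A' B' C') {v : EuclideanSpace ℝ (Fin n)}
    {S : Set (EuclideanSpace ℝ (Fin n)) → Set (EuclideanSpace ℝ (Fin n))}
    (hS : IsImprovingSymmetrization S v R) :
    ReachableTriple R A B C (S A') (S B') (S C') where
  mA := hS.measurableSet h.mA
  mB := hS.measurableSet h.mB
  mC := hS.measurableSet h.mC
  subA := hS.subset_ball h.subA
  subB := hS.subset_ball h.subB
  subC := hS.subset_ball h.subC
  volA := (hS.measure_eq h.mA h.subA).trans h.volA
  volB := (hS.measure_eq h.mB h.subB).trans h.volB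
  volC := (hS.measure_eq h.mC h.subC).trans h.volC
  le := h.le.trans (hS.tripleOverlap_le h.mA h.mB h.mC h.subA h.subB h.subC)

/-- Repeated symmetrization brings all three sets arbitrarily close to the centred balls of the same
measures. -/
theorem exists_reachableTriple_lt {n : ℕ} (hn : 1 ≤ n) {R a b c : ℝ} (hR : 0 < R)
    (haR : a ≤ R) (hbR : b ≤ R) (hcR : c ≤ R) {A B C : Set (EuclideanSpace ℝ (Fin n))}
    (hA : MeasurableSet A) (hB : MeasurableSet B) (hC : MeasurableSet C)
    (hAR : A ⊆ ball 0 R) (hBR : B ⊆ ball 0 R) (hCR : C ⊆ ball 0 R)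
    (ha : volume (ball (0 : EuclideanSpace ℝ (Fin n)) a) = volume A)
    (hb : volume (ball (0 : EuclideanSpace ℝ (Fin n)) b) = volume B)
    (hc : volume (ball (0 : EuclideanSpace ℝ (Fin n)) c) = volume C) {ε : ℝ} (hε : 0 < ε) :
    ∃ A' B' C', ReachableTriple R A B C A' B' C' ∧ volume.real (A' \ ball 0 a) +
      volume.real (B' \ ball 0 b) + volume.real (C' \ ball 0 c) < ε := by
  obtain ⟨m, rfl⟩ : ∃ m, n = m + 1 := ⟨n - 1, by omega⟩
  by_contra! hcon
  set W := volume.real (ball (0 : EuclideanSpace ℝ (Fin (m + 1))) (2 * R)) with hW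
  have hW0 : 0 < W := ENNReal.toReal_pos (measure_ball_pos _ _ (by positivity)).ne'
    measure_ball_lt_top.ne
  have hfin : ∀ {X : Set (EuclideanSpace ℝ (Fin (m + 1)))} (r : ℝ), X ⊆ ball 0 R →
      volume (X \ ball 0 r) ≠ ∞ := fun r hX =>
    ((measure_mono (sdiff_subset.trans hX)).trans_lt measure_ball_lt_top).ne
  have hle : ∀ {X v S}, IsImprovingSymmetrization S v R → ∀ r : ℝ, MeasurableSet X → X ⊆ ball 0 R →
      volume.real (S X \ ball 0 r) ≤ volume.real (X \ ball 0 r) := fun hS r hX hXR =>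
    ENNReal.toReal_mono (hfin r hXR) (hS.measure_sdiff_le r hX hXR)
  have hgain : ∀ {X : Set (EuclideanSpace ℝ (Fin (m + 1)))} {r : ℝ}, r ≤ R → MeasurableSet X →
      X ⊆ ball 0 R → volume (ball (0 : EuclideanSpace ℝ (Fin (m + 1))) r) = volume X →
      ε / 3 ≤ volume.real (X \ ball 0 r) → ∃ v S, IsImprovingSymmetrization S v R ∧
        volume.real (S X \ ball 0 r) + (ε / 3) ^ 2 / W ≤ volume.real (X \ ball 0 r) := by
    intro X r hr hX hXR hXr hε'
    obtain ⟨v, hv, hvS⟩ := exists_direction_measure_sdiff_add_le hn hR hr hX hXR hXr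
    obtain ⟨S, hS⟩ := exists_isImprovingSymmetrization hv R
    refine ⟨v, S, hS, ?_⟩
    have h1 := ENNReal.toReal_mono (hfin r hXR) (hvS S hS)
    rw [ENNReal.toReal_add (hfin r (hS.subset_ball hXR)) (ENNReal.div_ne_top
      (ENNReal.mul_ne_top (hfin r hXR) (hfin r hXR)) (measure_ball_pos _ _ (by positivity)).ne'),
      ENNReal.toReal_div, ENNReal.toReal_mul, ← sq] at h1
    refine le_trans (add_le_add_right ?_ _) h1
    change _ ≤ volume.real (X \ ball 0 r) ^ 2 / W
    gcongr
  -- While the total defect is at least `ε`, one of the three defects is at least `ε / 3`, and each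
  -- step decreases the total by a fixed amount.
  have hiter : ∀ k : ℕ, ∃ A' B' C', ReachableTriple R A B C A' B' C' ∧
      volume.real (A' \ ball 0 a) + volume.real (B' \ ball 0 b) + volume.real (C' \ ball 0 c) +
        k * ((ε / 3) ^ 2 / W) ≤
      volume.real (A \ ball 0 a) + volume.real (B \ ball 0 b) + volume.real (C \ ball 0 c) := by
    intro k
    induction k with
    | zero => exact ⟨A, B, C, ⟨hA, hB, hC, hAR, hBR, hCR, rfl, rfl, rfl, le_rfl⟩, by simp⟩
    | succ k ih =>
      obtain ⟨A', B', C', h, hk⟩ := ih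
      have h3 := hcon A' B' C' h
      suffices ∃ v S, IsImprovingSymmetrization S v R ∧
          volume.real (S A' \ ball 0 a) + volume.real (S B' \ ball 0 b) +
            volume.real (S C' \ ball 0 c) + (ε / 3) ^ 2 / W ≤
          volume.real (A' \ ball 0 a) + volume.real (B' \ ball 0 b) +
            volume.real (C' \ ball 0 c) by
        obtain ⟨v, S, hS, hle⟩ := this
        refine ⟨_, _, _, h.step hS, ?_⟩
        push_cast
        linarith
      have hcase : ε / 3 ≤ volume.real (A' \ ball 0 a) ∨ ε / 3 ≤ volume.real (B' \ ball 0 b) ∨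
          ε / 3 ≤ volume.real (C' \ ball 0 c) := by
        by_contra! h'
        linarith [h'.1, h'.2.1, h'.2.2]
      rcases hcase with h' | h' | h'
      · obtain ⟨v, S, hS, hg⟩ := hgain haR h.mA h.subA (ha.trans h.volA.symm) h'
        exact ⟨v, S, hS, by linarith [hle hS b h.mB h.subB, hle hS c h.mC h.subC]⟩
      · obtain ⟨v, S, hS, hg⟩ := hgain hbR h.mB h.subB (hb.trans h.volB.symm) h'
        exact ⟨v, S, hS, by linarith [hle hS a h.mA h.subA, hle hS c h.mC h.subC]⟩
      · obtain ⟨v, S, hS, hg⟩ := hgain hcR h.mC h.subC (hc.trans h.volC.symm) h'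
        exact ⟨v, S, hS, by linarith [hle hS a h.mA h.subA, hle hS b h.mB h.subB]⟩
  have hη : 0 < (ε / 3) ^ 2 / W := by positivity
  obtain ⟨k, hk⟩ := exists_nat_gt ((volume.real (A \ ball 0 a) + volume.real (B \ ball 0 b) +
    volume.real (C \ ball 0 c)) / ((ε / 3) ^ 2 / W))
  rw [div_lt_iff₀ hη] at hk
  obtain ⟨A', B', C', h, hk'⟩ := hiter k
  have := hcon A' B' C' h
  linarith

theorem tripleOverlap_le_ball_of_subset {n : ℕ} (hn : 1 ≤ n) {R a b c : ℝ} (hR : 0 < R)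
    (haR : a ≤ R) (hbR : b ≤ R) (hcR : c ≤ R) {A B C : Set (EuclideanSpace ℝ (Fin n))}
    (hA : MeasurableSet A) (hB : MeasurableSet B) (hC : MeasurableSet C)
    (hAR : A ⊆ ball 0 R) (hBR : B ⊆ ball 0 R) (hCR : C ⊆ ball 0 R)
    (ha : volume (ball (0 : EuclideanSpace ℝ (Fin n)) a) = volume A)
    (hb : volume (ball (0 : EuclideanSpace ℝ (Fin n)) b) = volume B)
    (hc : volume (ball (0 : EuclideanSpace ℝ (Fin n)) c) = volume C) :
    tripleOverlap volume A B C ≤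
      tripleOverlap volume (ball (0 : EuclideanSpace ℝ (Fin n)) a) (ball 0 b) (ball 0 c) := by
  set W := volume.real (ball (0 : EuclideanSpace ℝ (Fin n)) R) with hW
  have hW0 : 0 ≤ W := ENNReal.toReal_nonneg
  have hW' : volume (ball (0 : EuclideanSpace ℝ (Fin n)) R) = ENNReal.ofReal W :=
    (ENNReal.ofReal_toReal measure_ball_lt_top.ne).symm
  refine ENNReal.le_of_forall_pos_le_add fun ε hε _ => ?_
  have hε' : (0 : ℝ) < ε / (W + 1) := by positivity
  obtain ⟨A', B', C', h, hlt⟩ := exists_reachableTriple_lt hn hR haR hbR hcR hA hB hC hAR hBR hCR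
    ha hb hc hε'
  have hfin : ∀ {X : Set (EuclideanSpace ℝ (Fin n))} (r : ℝ), X ⊆ ball 0 R →
      volume (X \ ball 0 r) = ENNReal.ofReal (volume.real (X \ ball 0 r)) := fun r hX =>
    (ENNReal.ofReal_toReal
      ((measure_mono (sdiff_subset.trans hX)).trans_lt measure_ball_lt_top).ne).symm
  refine (h.le.trans (tripleOverlap_le_add volume A' B' C' (A' := ball 0 a) (B' := ball 0 b)
    (C' := ball 0 c) measurableSet_ball)).trans (add_le_add_right ?_ _)
  calc _ ≤ (ENNReal.ofReal (volume.real (A' \ ball 0 a)) +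
          ENNReal.ofReal (volume.real (B' \ ball 0 b))) * ENNReal.ofReal W +
        ENNReal.ofReal W * ENNReal.ofReal (volume.real (C' \ ball 0 c)) := by
        rw [hfin a h.subA, hfin b h.subB, hfin c h.subC, ← hW']
        gcongr
        exact h.subC
    _ = ENNReal.ofReal (W * (volume.real (A' \ ball 0 a) + volume.real (B' \ ball 0 b) +
        volume.real (C' \ ball 0 c))) := by
        rw [ENNReal.ofReal_mul hW0, ENNReal.ofReal_add (by positivity) (by positivity),
          ENNReal.ofReal_add (by positivity) (by positivity)]
        ring
    _ ≤ ENNReal.ofReal ε := by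
        refine ENNReal.ofReal_le_ofReal ?_
        rw [lt_div_iff₀ (by positivity)] at hlt
        have : 0 ≤ volume.real (A' \ ball 0 a) + volume.real (B' \ ball 0 b) +
          volume.real (C' \ ball 0 c) := by positivity
        nlinarith
    _ = ε := ENNReal.ofReal_coe_nnreal

/-- The radius of a ball of volume `V < ∞` in `ℝⁿ`. -/
noncomputable def ballRadius (n : ℕ) (V : ℝ≥0∞) : ℝ :=
  (V.toReal / (volume (ball (0 : EuclideanSpace ℝ (Fin n)) 1)).toReal) ^ (1 / (n : ℝ))

theorem ballRadius_nonneg (n : ℕ) (V : ℝ≥0∞) : 0 ≤ ballRadius n V := by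
  unfold ballRadius; positivity

theorem ballRadius_mono (n : ℕ) {V W : ℝ≥0∞} (h : V ≤ W) (hW : W ≠ ∞) :
    ballRadius n V ≤ ballRadius n W := by
  unfold ballRadius
  have := ENNReal.toReal_mono hW h
  gcongr

theorem volume_ball_ballRadius {n : ℕ} (hn : 1 ≤ n) {V : ℝ≥0∞} (hV : V ≠ ∞) :
    volume (ball (0 : EuclideanSpace ℝ (Fin n)) (ballRadius n V)) = V := by
  have hb0 : volume (ball (0 : EuclideanSpace ℝ (Fin n)) 1) ≠ 0 :=
    (measure_ball_pos _ _ one_pos).ne'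
  have hb1 : volume (ball (0 : EuclideanSpace ℝ (Fin n)) 1) ≠ ∞ := measure_ball_lt_top.ne
  have : Nonempty (Fin n) := ⟨⟨0, hn⟩⟩
  rw [Measure.addHaar_ball _ _ (ballRadius_nonneg n V), finrank_euclideanSpace_fin, ballRadius,
    ← Real.rpow_natCast, ← Real.rpow_mul (by positivity),
    one_div_mul_cancel (by positivity), Real.rpow_one, ENNReal.ofReal_div_of_pos
      (ENNReal.toReal_pos hb0 hb1), ENNReal.ofReal_toReal hV, ENNReal.ofReal_toReal hb1,
    ENNReal.div_mul_cancel hb0 hb1]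

theorem tendsto_measure_sdiff_ball {n : ℕ} {A : Set (EuclideanSpace ℝ (Fin n))}
    (hA : MeasurableSet A) (hfin : volume A ≠ ∞) :
    Filter.Tendsto (fun k : ℕ => volume (A \ (A ∩ ball 0 (k : ℝ)))) Filter.atTop (nhds 0) := by
  have h := tendsto_measure_iInter_atTop (μ := volume)
    (s := fun k : ℕ => A \ (A ∩ ball 0 (k : ℝ)))
    (fun k => (hA.diff (hA.inter measurableSet_ball)).nullMeasurableSet)
    (fun i j hij => sdiff_subset_sdiff_right (inter_subset_inter_right _
      (ball_subset_ball (by exact_mod_cast hij))))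
    ⟨0, ((measure_mono sdiff_subset).trans_lt hfin.lt_top).ne⟩
  have he : ⋂ k : ℕ, A \ (A ∩ ball 0 (k : ℝ)) = ∅ := by
    ext x
    simp only [mem_iInter, mem_empty_iff_false, iff_false, not_forall]
    obtain ⟨k, hk⟩ := exists_nat_gt ‖x‖
    exact ⟨k, fun h => h.2 ⟨h.1, by simpa using hk⟩⟩
  rwa [he, measure_empty] at h

/-- The **Riesz rearrangement inequality** for sets of finite measure. -/
theorem tripleOverlap_le_ball {n : ℕ} (hn : 1 ≤ n) {A B C : Set (EuclideanSpace ℝ (Fin n))}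
    (hA : MeasurableSet A) (hB : MeasurableSet B) (hC : MeasurableSet C)
    (hA' : volume A ≠ ∞) (hB' : volume B ≠ ∞) (hC' : volume C ≠ ∞) :
    tripleOverlap volume A B C ≤ tripleOverlap volume
      (ball (0 : EuclideanSpace ℝ (Fin n)) (ballRadius n (volume A)))
      (ball 0 (ballRadius n (volume B))) (ball 0 (ballRadius n (volume C))) := by
  set T := tripleOverlap volume (ball (0 : EuclideanSpace ℝ (Fin n)) (ballRadius n (volume A)))
      (ball 0 (ballRadius n (volume B))) (ball 0 (ballRadius n (volume C)))
  have hbound : ∀ k : ℕ, tripleOverlap volume A B C ≤ T +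
      ((volume (A \ (A ∩ ball 0 (k : ℝ))) + volume (B \ (B ∩ ball 0 (k : ℝ)))) * volume C +
        volume A * volume (C \ (C ∩ ball 0 (k : ℝ)))) := by
    intro k
    have hsub : ∀ {X : Set (EuclideanSpace ℝ (Fin n))}, volume X ≠ ∞ →
        volume (X ∩ ball 0 (k : ℝ)) ≠ ∞ := fun hX =>
      ((measure_mono inter_subset_left).trans_lt hX.lt_top).ne
    refine (tripleOverlap_le_add volume A B C (A' := A ∩ ball 0 (k : ℝ)) (B' := B ∩ ball 0 (k : ℝ))
      (hC.inter (measurableSet_ball (x := 0) (ε := (k : ℝ))))).trans ?_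
    refine add_le_add ?_ (by gcongr; exact inter_subset_left)
    set R := max (max (ballRadius n (volume (A ∩ ball 0 (k : ℝ))))
      (ballRadius n (volume (B ∩ ball 0 (k : ℝ)))))
      (max (ballRadius n (volume (C ∩ ball 0 (k : ℝ)))) ((k : ℝ) + 1)) with hRdef
    have hkR : (k : ℝ) + 1 ≤ R := (le_max_right _ _).trans (le_max_right _ _)
    have hR : 0 < R := lt_of_lt_of_le (by positivity) hkR
    have hin : ∀ {X : Set (EuclideanSpace ℝ (Fin n))}, X ∩ ball 0 (k : ℝ) ⊆ ball 0 R := fun {X} =>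
      inter_subset_right.trans (ball_subset_ball (by linarith))
    refine (tripleOverlap_le_ball_of_subset hn hR ((le_max_left _ _).trans (le_max_left _ _))
      ((le_max_right _ _).trans (le_max_left _ _)) ((le_max_left _ _).trans (le_max_right _ _))
      (hA.inter measurableSet_ball) (hB.inter measurableSet_ball) (hC.inter measurableSet_ball)
      hin hin hin (volume_ball_ballRadius hn (hsub hA')) (volume_ball_ballRadius hn (hsub hB'))
      (volume_ball_ballRadius hn (hsub hC'))).trans ?_
    exact tripleOverlap_mono _
      (ball_subset_ball (ballRadius_mono n (measure_mono inter_subset_left) hA'))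
      (ball_subset_ball (ballRadius_mono n (measure_mono inter_subset_left) hB'))
      (ball_subset_ball (ballRadius_mono n (measure_mono inter_subset_left) hC'))
  have hlim := (tendsto_const_nhds (x := T)).add ((ENNReal.Tendsto.mul_const
    ((tendsto_measure_sdiff_ball hA hA').add (tendsto_measure_sdiff_ball hB hB'))
    (b := volume C) (Or.inr hC')).add (ENNReal.Tendsto.const_mul
    (tendsto_measure_sdiff_ball hC hC') (a := volume A) (Or.inr hA')))
  simp only [add_zero, zero_mul, mul_zero] at hlim
  exact ge_of_tendsto' hlim hbound

/-! ### Intersections of balls -/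

/-- The intersection of a centred ball with a ball of centre `c` does not grow when `c` moves away
from the origin. The reflection `σ` that exchanges the two centres maps `E' \ E` into `E \ E'`,
where `E` and `E'` are the intersections for `c` and `c'`: it moves the points that are closer to
`c'` than to `c` towards the origin. -/
theorem volume_ball_inter_ball_le {n : ℕ} {c c' : EuclideanSpace ℝ (Fin n)} (h : ‖c‖ ≤ ‖c'‖)
    (a b : ℝ) : volume (ball 0 a ∩ ball c' b) ≤ volume (ball 0 a ∩ ball c b) := by
  rcases eq_or_ne c' c with rfl | hne
  · exact le_rfl
  set u := c' - c with hu
  have hu0 : 0 < ‖u‖ ^ 2 := by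
    have := norm_pos_iff.2 (sub_ne_zero.2 hne)
    positivity
  set d := (1 / 2 : ℝ) • (c + c') with hd
  set U := Submodule.reflection (ℝ ∙ u)ᗮ with hU
  have hUx : ∀ x, U x = x - (2 * (inner ℝ u x / ‖u‖ ^ 2)) • u := fun x => by
    rw [hU, Submodule.reflection_orthogonal_apply, Submodule.reflection_singleton_apply]
    simp only [RCLike.ofReal_real_eq_id, id_eq, two_smul]
    module
  have hUu : U u = -u := by
    rw [hUx, real_inner_self_eq_norm_sq, div_self hu0.ne']
    module
  set σ : EuclideanSpace ℝ (Fin n) → EuclideanSpace ℝ (Fin n) := fun x => U (x - d) + d with hσ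
  have hσm : MeasurePreserving σ volume volume :=
    (measurePreserving_add_right volume d).comp
      (U.measurePreserving.comp (measurePreserving_sub_right volume d))
  have hdist : ∀ x y, ‖σ x - σ y‖ = ‖x - y‖ := fun x y => by
    simp only [hσ]
    rw [add_sub_add_right_eq_sub, ← map_sub, U.norm_map, sub_sub_sub_cancel_right]
  have hcd : c - d = (-(1 / 2) : ℝ) • u := by rw [hd, hu]; module
  have hcd' : c' - d = (1 / 2 : ℝ) • u := by rw [hd, hu]; module
  have hσc : σ c = c' := by
    simp only [hσ]
    rw [hcd, map_smul, hUu, hd, hu]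
    module
  have hσc' : σ c' = c := by
    simp only [hσ]
    rw [hcd', map_smul, hUu, hd, hu]
    module
  have hdu : 0 ≤ inner ℝ u d := by
    have : inner ℝ u d = (‖c'‖ ^ 2 - ‖c‖ ^ 2) / 2 := by
      rw [hu, hd, inner_smul_right, inner_sub_left, inner_add_right, inner_add_right,
        real_inner_self_eq_norm_sq, real_inner_self_eq_norm_sq, real_inner_comm c c']
      ring
    rw [this]
    have := pow_le_pow_left₀ (norm_nonneg c) h 2
    linarith
  have hnorm : ∀ x, ‖x - c'‖ < ‖x - c‖ → ‖σ x‖ ≤ ‖x‖ := by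
    intro x hx
    have hk : 0 < inner ℝ u (x - d) := by
      have h1 : ‖x - c‖ ^ 2 - ‖x - c'‖ ^ 2 = 2 * inner ℝ u (x - d) := by
        have e1 : x - c = (x - d) + (1 / 2 : ℝ) • u := by rw [hd, hu]; module
        have e2 : x - c' = (x - d) - (1 / 2 : ℝ) • u := by rw [hd, hu]; module
        rw [e1, e2, norm_add_sq_real (x - d), norm_sub_sq_real (x - d), inner_smul_right,
          real_inner_comm u (x - d)]
        ring
      have h2 := pow_lt_pow_left₀ hx (norm_nonneg _) two_ne_zero
      linarith
    set k := inner ℝ u (x - d) / ‖u‖ ^ 2 with hkdef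
    have hk' : 0 < k := div_pos hk hu0
    have e : σ x = x - (2 * k) • u := by
      simp only [hσ, hUx, ← hkdef]
      abel
    have hxu : inner ℝ x u = k * ‖u‖ ^ 2 + inner ℝ u d := by
      rw [hkdef, div_mul_cancel₀ _ hu0.ne', real_inner_comm u x, inner_sub_right u x d]
      ring
    have : ‖σ x‖ ^ 2 ≤ ‖x‖ ^ 2 := by
      rw [e, norm_sub_sq_real, inner_smul_right, norm_smul, hxu, mul_pow, Real.norm_eq_abs, sq_abs]
      nlinarith [mul_nonneg hk'.le hdu]
    exact (sq_le_sq₀ (norm_nonneg _) (norm_nonneg _)).1 this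
  have hsub : (ball 0 a ∩ ball c' b) \ (ball 0 a ∩ ball c b) ⊆
      σ ⁻¹' ((ball 0 a ∩ ball c b) \ (ball 0 a ∩ ball c' b)) := by
    rintro x ⟨⟨hxa, hxb⟩, hx⟩
    have hxc : b ≤ ‖x - c‖ := by
      by_contra! hlt
      exact hx ⟨hxa, mem_ball_iff_norm.2 hlt⟩
    rw [mem_ball_iff_norm] at hxb
    rw [mem_ball_zero_iff] at hxa
    refine ⟨⟨?_, ?_⟩, fun hx' => ?_⟩
    · exact mem_ball_zero_iff.2 ((hnorm x (hxb.trans_le hxc)).trans_lt hxa)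
    · rw [mem_ball_iff_norm, ← hσc', hdist]
      exact hxb
    · have := hx'.2
      rw [mem_ball_iff_norm, ← hσc, hdist] at this
      linarith
  have mE : ∀ y : EuclideanSpace ℝ (Fin n), MeasurableSet (ball 0 a ∩ ball y b) := fun y =>
    measurableSet_ball.inter measurableSet_ball
  have h1 := (measure_mono hsub).trans_eq
    (hσm.measure_preimage ((mE c).diff (mE c')).nullMeasurableSet)
  rw [← measure_inter_add_sdiff (ball 0 a ∩ ball c' b) (mE c),
    ← measure_inter_add_sdiff (ball 0 a ∩ ball c b) (mE c'),
    inter_comm (ball 0 a ∩ ball c' b)]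
  gcongr

theorem volume_ball_inter_translate_le {n : ℕ} {ξ ξ' : EuclideanSpace ℝ (Fin n)} (h : ‖ξ‖ ≤ ‖ξ'‖)
    (a b : ℝ) : volume (ball 0 a ∩ (fun x => x + ξ') ⁻¹' ball 0 b) ≤
      volume (ball 0 a ∩ (fun x => x + ξ) ⁻¹' ball 0 b) := by
  have e : ∀ y : EuclideanSpace ℝ (Fin n), (fun x => x + y) ⁻¹' ball 0 b = ball (-y) b := by
    intro y
    ext x
    simp
  rw [e, e]
  exact volume_ball_inter_ball_le (by simpa using h) a b

/-! ### Powers as mixtures of truncated linear functions -/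

/-- For `p ≥ 1`, the function `t ↦ (t₊)^p` is a mixture of the functions `t ↦ (t - r)₊`, `r ≥ 0`:
the mixing measure is the Dirac measure at `0` for `p = 1` and has density `p (p - 1) r^(p - 2)` for
`p > 1`. -/
theorem exists_measure_rpow_eq {p : ℝ} (hp : 1 ≤ p) : ∃ μ : Measure ℝ, SFinite μ ∧
    (∀ᵐ r ∂μ, 0 ≤ r) ∧ ∀ t : ℝ, ENNReal.ofReal t ^ p = ∫⁻ r, ENNReal.ofReal (t - r) ∂μ := by
  rcases hp.eq_or_lt with rfl | hp
  · refine ⟨Measure.dirac 0, inferInstance, ?_, fun t => ?_⟩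
    · simp [ae_dirac_eq]
    · simp
  have hmeas : Measurable fun r : ℝ => ENNReal.ofReal (p * (p - 1) * r ^ (p - 2)) := by fun_prop
  refine ⟨(volume.restrict (Ioi (0 : ℝ))).withDensity
    fun r => ENNReal.ofReal (p * (p - 1) * r ^ (p - 2)), inferInstance, ?_, fun t => ?_⟩
  · refine (withDensity_absolutelyContinuous _ _).ae_le ?_
    filter_upwards [ae_restrict_mem measurableSet_Ioi] with r hr using (mem_Ioi.1 hr).le
  rw [lintegral_withDensity_eq_lintegral_mul _ hmeas (by fun_prop)]
  rcases le_or_gt t 0 with ht | ht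
  · rw [ENNReal.ofReal_of_nonpos ht, ENNReal.zero_rpow_of_pos (by linarith)]
    symm
    rw [setLIntegral_eq_zero_iff measurableSet_Ioi (by fun_prop)]
    refine Filter.Eventually.of_forall fun r (hr : 0 < r) => ?_
    simp [ENNReal.ofReal_of_nonpos (show t - r ≤ 0 by linarith)]
  have h1 : ∫⁻ r in Ioi (0 : ℝ), ((fun r => ENNReal.ofReal (p * (p - 1) * r ^ (p - 2))) *
      fun r => ENNReal.ofReal (t - r)) r =
      ∫⁻ r in Ioc 0 t, ENNReal.ofReal (p * (p - 1) * (t * r ^ (p - 2) - r ^ (p - 1))) := by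
    rw [← lintegral_indicator measurableSet_Ioi, ← lintegral_indicator measurableSet_Ioc]
    refine lintegral_congr fun r => ?_
    by_cases hr : 0 < r
    · rw [indicator_of_mem (mem_Ioi.2 hr), Pi.mul_apply]
      have hrp : r ^ (p - 1) = r ^ (p - 2) * r := by
        rw [← Real.rpow_add_one hr.ne']; congr 1; ring
      by_cases hrt : r ≤ t
      · rw [indicator_of_mem (mem_Ioc.2 ⟨hr, hrt⟩), ← ENNReal.ofReal_mul
          (mul_nonneg (mul_nonneg (by linarith) (by linarith)) (Real.rpow_nonneg hr.le _)), hrp]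
        congr 1; ring
      · rw [indicator_of_notMem (fun h => hrt h.2),
          ENNReal.ofReal_of_nonpos (show t - r ≤ 0 by linarith), mul_zero]
    · rw [indicator_of_notMem (by simpa using hr), indicator_of_notMem (fun h => hr h.1)]
  have hi2 : IntervalIntegrable (fun r : ℝ => r ^ (p - 2)) volume 0 t :=
    intervalIntegral.intervalIntegrable_rpow' (by linarith)
  have hi1 : IntervalIntegrable (fun r : ℝ => r ^ (p - 1)) volume 0 t :=
    intervalIntegral.intervalIntegrable_rpow' (by linarith)
  have hi : IntervalIntegrable (fun r : ℝ => p * (p - 1) * (t * r ^ (p - 2) - r ^ (p - 1)))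
      volume 0 t := ((hi2.const_mul t).sub hi1).const_mul _
  rw [h1, ← ofReal_integral_eq_lintegral_ofReal
    ((intervalIntegrable_iff_integrableOn_Ioc_of_le ht.le).1 hi),
    ← intervalIntegral.integral_of_le ht.le, intervalIntegral.integral_const_mul,
    intervalIntegral.integral_sub (hi2.const_mul t) hi1, intervalIntegral.integral_const_mul,
    integral_rpow (Or.inl (by linarith)), integral_rpow (Or.inl (by linarith)),
    ENNReal.ofReal_rpow_of_pos ht]
  · congr 1
    have e1 : p - 2 + 1 = p - 1 := by ring
    have e2 : p - 1 + 1 = p := by ring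
    rw [e1, e2, Real.zero_rpow (by linarith), Real.zero_rpow (by linarith), sub_zero, sub_zero]
    have e3 : t ^ p = t ^ (p - 1) * t := by rw [← Real.rpow_add_one ht.ne']; congr 1; ring
    rw [e3]
    have : p - 1 ≠ 0 := by linarith
    have : p ≠ 0 := by linarith
    field_simp
    ring
  · filter_upwards [ae_restrict_mem measurableSet_Ioc] with r hr
    have hrp : r ^ (p - 1) = r ^ (p - 2) * r := by
      rw [← Real.rpow_add_one hr.1.ne']; congr 1; ring
    have : t * r ^ (p - 2) - r ^ (p - 1) = r ^ (p - 2) * (t - r) := by rw [hrp]; ring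
    rw [this]
    exact mul_nonneg (mul_nonneg (by linarith) (by linarith))
      (mul_nonneg (Real.rpow_nonneg hr.1.le _) (by linarith [hr.2]))

/-- Layer-cake formula for `((a - b)₊)^p`: a single measure on pairs `(r, τ)` serves for all `a`
and all `b ≥ 0`, and the condition on `(r, τ)` separates `a` from `b`. -/
theorem exists_measure_prod_rpow_eq {p : ℝ} (hp : 1 ≤ p) : ∃ m : Measure (ℝ × ℝ), SFinite m ∧
    (∀ᵐ ρ ∂m, 0 ≤ ρ.1 ∧ 0 < ρ.2) ∧ ∀ a b : ℝ, 0 ≤ b →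
      ENNReal.ofReal (a - b) ^ p = m {ρ | b ≤ ρ.2 ∧ ρ.1 + ρ.2 < a} := by
  obtain ⟨μ, hμ, hμ0, hμp⟩ := exists_measure_rpow_eq hp
  refine ⟨μ.prod (volume.restrict (Ioi 0)), inferInstance, ?_, fun a b hb => ?_⟩
  · have h1 : ∀ᵐ ρ ∂(μ.prod (volume.restrict (Ioi (0 : ℝ)))), 0 ≤ ρ.1 :=
      Measure.quasiMeasurePreserving_fst.ae hμ0
    have h2 : ∀ᵐ ρ ∂(μ.prod (volume.restrict (Ioi (0 : ℝ)))), 0 < ρ.2 :=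
      Measure.quasiMeasurePreserving_snd.ae (ae_restrict_mem measurableSet_Ioi)
    exact h1.and h2
  · have hS : MeasurableSet {ρ : ℝ × ℝ | b ≤ ρ.2 ∧ ρ.1 + ρ.2 < a} :=
      (measurableSet_le measurable_const measurable_snd).inter
        (measurableSet_lt (measurable_fst.add measurable_snd) measurable_const)
    rw [Measure.prod_apply hS, hμp]
    refine lintegral_congr fun r => ?_
    have e : Prod.mk r ⁻¹' {ρ : ℝ × ℝ | b ≤ ρ.2 ∧ ρ.1 + ρ.2 < a} = Ico b (a - r) := by
      ext τ
      simp only [preimage_ofPred_eq, mem_ofPred_eq, mem_Ico]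
      constructor <;> rintro ⟨h1, h2⟩ <;> exact ⟨h1, by linarith⟩
    rw [e, restrict_Ioi_eq_restrict_Ici, Measure.restrict_apply measurableSet_Ico,
      inter_eq_left.2 (Ico_subset_Ici_self.trans (Ici_subset_Ici.2 hb)), Real.volume_Ico]
    congr 1; ring

/-! ### Translation energies of functions and of their rearrangements -/

/-- The measure of the points `x` with `x ∈ A`, `x + ξ ∉ B` plus that of the points with
`x + ξ ∈ A`, `x ∉ B`. -/
noncomputable def translateDiscrepancy {n : ℕ} (A B : Set (EuclideanSpace ℝ (Fin n)))
    (ξ : EuclideanSpace ℝ (Fin n)) : ℝ≥0∞ :=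
  volume (A \ (fun x => x + ξ) ⁻¹' B) + volume ((fun x => x + ξ) ⁻¹' A \ B)

theorem translateDiscrepancy_add {n : ℕ} {A B : Set (EuclideanSpace ℝ (Fin n))}
    (hB : MeasurableSet B) (ξ : EuclideanSpace ℝ (Fin n)) :
    translateDiscrepancy A B ξ + (volume (A ∩ (fun x => x + ξ) ⁻¹' B) +
      volume (B ∩ (fun x => x + ξ) ⁻¹' A)) = 2 * volume A := by
  have h1 := measure_inter_add_sdiff (μ := volume) A ((measurable_add_const ξ) hB)
  have h2 := measure_inter_add_sdiff (μ := volume) ((fun x => x + ξ) ⁻¹' A) hB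
  rw [measure_preimage_add_right, inter_comm] at h2
  calc _ = (volume (A ∩ (fun x => x + ξ) ⁻¹' B) + volume (A \ (fun x => x + ξ) ⁻¹' B)) +
        (volume (B ∩ (fun x => x + ξ) ⁻¹' A) + volume ((fun x => x + ξ) ⁻¹' A \ B)) := by
        rw [translateDiscrepancy]; abel
    _ = 2 * volume A := by rw [h1, h2, two_mul]

theorem measurable_translateDiscrepancy {n : ℕ} {A B : Set (EuclideanSpace ℝ (Fin n))}
    (hA : MeasurableSet A) (hB : MeasurableSet B) : Measurable (translateDiscrepancy A B) := by
  have h1 : MeasurableSet {q : EuclideanSpace ℝ (Fin n) × EuclideanSpace ℝ (Fin n) |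
      q.2 ∈ A ∧ q.2 + q.1 ∉ B} :=
    (measurable_snd hA).inter ((measurable_snd.add measurable_fst) hB.compl)
  have h2 : MeasurableSet {q : EuclideanSpace ℝ (Fin n) × EuclideanSpace ℝ (Fin n) |
      q.2 + q.1 ∈ A ∧ q.2 ∉ B} :=
    ((measurable_snd.add measurable_fst) hA).inter (measurable_snd hB.compl)
  exact (measurable_measure_prodMk_left h1).add (measurable_measure_prodMk_left h2)

theorem translateDiscrepancy_congr {n : ℕ} {A A' B B' : Set (EuclideanSpace ℝ (Fin n))}
    (hA : A =ᵐ[volume] A') (hB : B =ᵐ[volume] B') (ξ : EuclideanSpace ℝ (Fin n)) :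
    translateDiscrepancy A B ξ = translateDiscrepancy A' B' ξ := by
  have hq := (measurePreserving_add_right volume ξ).quasiMeasurePreserving
  have hA' := hq.preimage_ae_eq hA
  have hB' := hq.preimage_ae_eq hB
  rw [translateDiscrepancy, translateDiscrepancy, measure_congr (hA.diff hB'),
    measure_congr (hA'.diff hB)]

theorem translateDiscrepancy_ball_mono {n : ℕ} {ξ ξ' : EuclideanSpace ℝ (Fin n)} (h : ‖ξ‖ ≤ ‖ξ'‖)
    (a b : ℝ) : translateDiscrepancy (ball 0 a) (ball 0 b) ξ ≤
      translateDiscrepancy (ball 0 a) (ball 0 b) ξ' := by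
  have h1 := translateDiscrepancy_add (A := ball 0 a) (B := ball 0 b) measurableSet_ball ξ
  have h2 := translateDiscrepancy_add (A := ball 0 a) (B := ball 0 b) measurableSet_ball ξ'
  have hle := add_le_add (volume_ball_inter_translate_le h a b)
    (volume_ball_inter_translate_le h b a)
  have hfin : volume (ball 0 a ∩ (fun x => x + ξ) ⁻¹' ball 0 b) +
      volume (ball 0 b ∩ (fun x => x + ξ) ⁻¹' ball 0 a) ≠ ∞ := by
    rw [ENNReal.add_ne_top]
    exact ⟨((measure_mono inter_subset_left).trans_lt measure_ball_lt_top).ne,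
      ((measure_mono inter_subset_left).trans_lt measure_ball_lt_top).ne⟩
  refine (ENNReal.add_le_add_iff_right hfin).1 ?_
  rw [h1, ← h2]
  gcongr

/-- The Riesz inequality for complements: the integral of the discrepancy and two overlap integrals
add up to `2 |A| |C|`. -/
theorem lintegral_translateDiscrepancy_ball_le {n : ℕ} (hn : 1 ≤ n)
    {A B C : Set (EuclideanSpace ℝ (Fin n))}
    (hA : MeasurableSet A) (hB : MeasurableSet B) (hC : MeasurableSet C)
    (hA' : volume A ≠ ∞) (hB' : volume B ≠ ∞) (hC' : volume C ≠ ∞) :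
    ∫⁻ ξ in ball (0 : EuclideanSpace ℝ (Fin n)) (ballRadius n (volume C)), translateDiscrepancy
      (ball 0 (ballRadius n (volume A))) (ball 0 (ballRadius n (volume B))) ξ ≤
    ∫⁻ ξ in C, translateDiscrepancy A B ξ := by
  have key : ∀ {A B : Set (EuclideanSpace ℝ (Fin n))} (C : Set (EuclideanSpace ℝ (Fin n))),
      MeasurableSet A → MeasurableSet B →
      (∫⁻ ξ in C, translateDiscrepancy A B ξ) +
        (tripleOverlap volume A B C + tripleOverlap volume B A C) = 2 * volume A * volume C := by
    intro A B C hA hB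
    rw [tripleOverlap, tripleOverlap, ← lintegral_add_left
      (measurable_measure_inter_translate volume hA hB),
      ← lintegral_add_left (measurable_translateDiscrepancy hA hB)]
    simp_rw [translateDiscrepancy_add hB]
    rw [setLIntegral_const]
  have h1 := key C hA hB
  have h2 := key (A := ball 0 (ballRadius n (volume A))) (B := ball 0 (ballRadius n (volume B)))
    (ball 0 (ballRadius n (volume C))) measurableSet_ball measurableSet_ball
  rw [volume_ball_ballRadius hn hA', volume_ball_ballRadius hn hC'] at h2
  have hle := add_le_add (tripleOverlap_le_ball hn hA hB hC hA' hB' hC')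
    (tripleOverlap_le_ball hn hB hA hC hB' hA' hC')
  have hfin : tripleOverlap volume A B C + tripleOverlap volume B A C ≠ ∞ := by
    refine ne_top_of_le_ne_top ?_ (le_of_le_of_eq le_add_self h1)
    finiteness
  refine (ENNReal.add_le_add_iff_right hfin).1 ?_
  rw [h1, ← h2]
  gcongr

/-- The `p`-th power of the `L^p` norm of `f(· + ξ) - f`. -/
noncomputable def translateEnergy {n : ℕ} (p : ℝ) (f : EuclideanSpace ℝ (Fin n) → ℝ)
    (ξ : EuclideanSpace ℝ (Fin n)) : ℝ≥0∞ :=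
  ∫⁻ x, ‖f (x + ξ) - f x‖ₑ ^ p

theorem measurable_translateEnergy {n : ℕ} {p : ℝ} {f : EuclideanSpace ℝ (Fin n) → ℝ}
    (hf : Measurable f) : Measurable (translateEnergy p f) := by
  have : Measurable fun q : EuclideanSpace ℝ (Fin n) × EuclideanSpace ℝ (Fin n) =>
      ‖f (q.2 + q.1) - f q.2‖ₑ ^ p :=
    (((hf.comp (measurable_snd.add measurable_fst)).sub (hf.comp measurable_snd)).enorm).pow_const p
  exact this.lintegral_prod_right'

theorem enorm_sub_rpow_eq {p : ℝ} (hp : 1 ≤ p) (a b : ℝ) :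
    ‖a - b‖ₑ ^ p = ENNReal.ofReal (a - b) ^ p + ENNReal.ofReal (b - a) ^ p := by
  rcases le_total a b with h | h
  · rw [ENNReal.ofReal_of_nonpos (show a - b ≤ 0 by linarith),
      ENNReal.zero_rpow_of_pos (by linarith), zero_add, Real.enorm_eq_ofReal_abs, abs_sub_comm,
      abs_of_nonneg (by linarith)]
  · rw [ENNReal.ofReal_of_nonpos (show b - a ≤ 0 by linarith),
      ENNReal.zero_rpow_of_pos (by linarith), add_zero, Real.enorm_eq_ofReal_abs,
      abs_of_nonneg (by linarith)]

theorem translateEnergy_eq_lintegral {n : ℕ} {p : ℝ} (hp : 1 ≤ p) {m : Measure (ℝ × ℝ)} [SFinite m]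
    (hm : ∀ a b : ℝ, 0 ≤ b → ENNReal.ofReal (a - b) ^ p = m {ρ | b ≤ ρ.2 ∧ ρ.1 + ρ.2 < a})
    {f : EuclideanSpace ℝ (Fin n) → ℝ} (hf : Measurable f) (hf0 : ∀ x, 0 ≤ f x)
    (ξ : EuclideanSpace ℝ (Fin n)) :
    translateEnergy p f ξ =
      ∫⁻ ρ, translateDiscrepancy {x | ρ.1 + ρ.2 < f x} {x | ρ.2 < f x} ξ ∂m := by
  have hfξ : Measurable fun x => f (x + ξ) := hf.comp (measurable_add_const ξ)
  have key : ∀ {u v : EuclideanSpace ℝ (Fin n) → ℝ}, Measurable u → Measurable v →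
      Measurable (fun x => m {ρ | v x ≤ ρ.2 ∧ ρ.1 + ρ.2 < u x}) ∧
      Measurable (fun ρ : ℝ × ℝ => volume {x | v x ≤ ρ.2 ∧ ρ.1 + ρ.2 < u x}) ∧
      ∫⁻ x, m {ρ | v x ≤ ρ.2 ∧ ρ.1 + ρ.2 < u x} =
        ∫⁻ ρ, volume {x | v x ≤ ρ.2 ∧ ρ.1 + ρ.2 < u x} ∂m := by
    intro u v hu hv
    have hS : MeasurableSet {q : EuclideanSpace ℝ (Fin n) × (ℝ × ℝ) |
        v q.1 ≤ q.2.2 ∧ q.2.1 + q.2.2 < u q.1} :=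
      (measurableSet_le (hv.comp measurable_fst) (measurable_snd.comp measurable_snd)).inter
        (measurableSet_lt ((measurable_fst.comp measurable_snd).add
          (measurable_snd.comp measurable_snd)) (hu.comp measurable_fst))
    refine ⟨measurable_measure_prodMk_left hS, measurable_measure_prodMk_right hS, ?_⟩
    have h1 := Measure.prod_apply (μ := volume) (ν := m) hS
    rw [Measure.prod_apply_symm hS] at h1
    exact h1.symm
  have e : ∀ x, ‖f (x + ξ) - f x‖ₑ ^ p = m {ρ | f x ≤ ρ.2 ∧ ρ.1 + ρ.2 < f (x + ξ)} +
      m {ρ | f (x + ξ) ≤ ρ.2 ∧ ρ.1 + ρ.2 < f x} := fun x => by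
    rw [enorm_sub_rpow_eq hp, hm _ _ (hf0 _), hm _ _ (hf0 _)]
  simp_rw [translateEnergy, e]
  obtain ⟨m1, m2, e1⟩ := key hfξ hf
  obtain ⟨m3, m4, e2⟩ := key hf hfξ
  rw [lintegral_add_left m1, e1, e2, ← lintegral_add_left m2]
  refine lintegral_congr fun ρ => ?_
  rw [translateDiscrepancy, add_comm]
  congr 2 <;> ext x <;> simp [and_comm]

/-- The superlevel sets of `g` at positive levels are, up to null sets, the centred balls with the
measures of those of `f`. -/
def IsBallRearrangement {n : ℕ} (f g : EuclideanSpace ℝ (Fin n) → ℝ) : Prop :=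
  ∀ τ : ℝ, 0 < τ → {x | τ < g x} =ᵐ[volume] ball 0 (ballRadius n (volume {x | τ < f x}))

theorem IsBallRearrangement.translateEnergy_eq {n : ℕ} {p : ℝ} (hp : 1 ≤ p)
    {m : Measure (ℝ × ℝ)} [SFinite m] (hm0 : ∀ᵐ ρ ∂m, 0 ≤ ρ.1 ∧ 0 < ρ.2)
    (hm : ∀ a b : ℝ, 0 ≤ b → ENNReal.ofReal (a - b) ^ p = m {ρ | b ≤ ρ.2 ∧ ρ.1 + ρ.2 < a})
    {f g : EuclideanSpace ℝ (Fin n) → ℝ} (hg : Measurable g) (hg0 : ∀ x, 0 ≤ g x)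
    (h : IsBallRearrangement f g) (ξ : EuclideanSpace ℝ (Fin n)) :
    translateEnergy p g ξ = ∫⁻ ρ, translateDiscrepancy
      (ball 0 (ballRadius n (volume {x | ρ.1 + ρ.2 < f x})))
      (ball 0 (ballRadius n (volume {x | ρ.2 < f x}))) ξ ∂m := by
  rw [translateEnergy_eq_lintegral hp hm hg hg0]
  refine lintegral_congr_ae ?_
  filter_upwards [hm0] with ρ hρ
  exact translateDiscrepancy_congr (h _ (by linarith [hρ.1, hρ.2])) (h _ hρ.2) ξ

theorem IsBallRearrangement.translateEnergy_mono {n : ℕ} {p : ℝ} (hp : 1 ≤ p)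
    {f g : EuclideanSpace ℝ (Fin n) → ℝ} (hg : Measurable g) (hg0 : ∀ x, 0 ≤ g x)
    (h : IsBallRearrangement f g) {ξ ξ' : EuclideanSpace ℝ (Fin n)} (hξ : ‖ξ‖ ≤ ‖ξ'‖) :
    translateEnergy p g ξ ≤ translateEnergy p g ξ' := by
  obtain ⟨m, _, hm0, hm⟩ := exists_measure_prod_rpow_eq hp
  rw [h.translateEnergy_eq hp hm0 hm hg hg0, h.translateEnergy_eq hp hm0 hm hg hg0]
  exact lintegral_mono fun ρ => translateDiscrepancy_ball_mono hξ _ _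

theorem measurable_translateDiscrepancy_superlevel {n : ℕ} {f : EuclideanSpace ℝ (Fin n) → ℝ}
    (hf : Measurable f) : Measurable fun q : EuclideanSpace ℝ (Fin n) × (ℝ × ℝ) =>
      translateDiscrepancy {x | q.2.1 + q.2.2 < f x} {x | q.2.2 < f x} q.1 := by
  have h1 : Measurable fun w : (EuclideanSpace ℝ (Fin n) × (ℝ × ℝ)) × EuclideanSpace ℝ (Fin n) =>
      w.1.2.1 + w.1.2.2 := by fun_prop
  have h2 : Measurable fun w : (EuclideanSpace ℝ (Fin n) × (ℝ × ℝ)) × EuclideanSpace ℝ (Fin n) =>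
      w.1.2.2 := by fun_prop
  have h3 : Measurable fun w : (EuclideanSpace ℝ (Fin n) × (ℝ × ℝ)) × EuclideanSpace ℝ (Fin n) =>
      f w.2 := by fun_prop
  have h4 : Measurable fun w : (EuclideanSpace ℝ (Fin n) × (ℝ × ℝ)) × EuclideanSpace ℝ (Fin n) =>
      f (w.2 + w.1.1) := by fun_prop
  exact (measurable_measure_prodMk_left
      ((measurableSet_lt h1 h3).diff (measurableSet_lt h2 h4))).add
    (measurable_measure_prodMk_left ((measurableSet_lt h1 h4).diff (measurableSet_lt h2 h3)))

/-- The integral of the translation energy over an arbitrary set of shifts does not increase if the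
function and the set are replaced by their rearrangements. -/
theorem IsBallRearrangement.lintegral_translateEnergy_le {n : ℕ} (hn : 1 ≤ n) {p : ℝ} (hp : 1 ≤ p)
    {f g : EuclideanSpace ℝ (Fin n) → ℝ} (hf : Measurable f) (hf0 : ∀ x, 0 ≤ f x)
    (hfin : ∀ τ : ℝ, 0 < τ → volume {x | τ < f x} ≠ ∞)
    (hg : Measurable g) (hg0 : ∀ x, 0 ≤ g x) (h : IsBallRearrangement f g)
    {C : Set (EuclideanSpace ℝ (Fin n))} (hC : MeasurableSet C) (hC' : volume C ≠ ∞) :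
    ∫⁻ ξ in ball (0 : EuclideanSpace ℝ (Fin n)) (ballRadius n (volume C)), translateEnergy p g ξ ≤
      ∫⁻ ξ in C, translateEnergy p f ξ := by
  obtain ⟨m, _, hm0, hm⟩ := exists_measure_prod_rpow_eq hp
  have swap : ∀ {u : EuclideanSpace ℝ (Fin n) → ℝ}, Measurable u → (∀ x, 0 ≤ u x) →
      ∀ D : Set (EuclideanSpace ℝ (Fin n)), ∫⁻ ξ in D, translateEnergy p u ξ =
        ∫⁻ ρ, (∫⁻ ξ in D,
          translateDiscrepancy {x | ρ.1 + ρ.2 < u x} {x | ρ.2 < u x} ξ) ∂m := by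
    intro u hu hu0 D
    simp_rw [translateEnergy_eq_lintegral hp hm hu hu0]
    exact lintegral_lintegral_swap (measurable_translateDiscrepancy_superlevel hu).aemeasurable
  rw [swap hg hg0, swap hf hf0]
  refine lintegral_mono_ae ?_
  filter_upwards [hm0] with ρ hρ
  have hρ' : 0 < ρ.1 + ρ.2 := by linarith [hρ.1, hρ.2]
  simp_rw [translateDiscrepancy_congr (h _ hρ') (h _ hρ.2)]
  exact lintegral_translateDiscrepancy_ball_le hn (measurableSet_lt measurable_const hf)
    (measurableSet_lt measurable_const hf) hC (hfin _ hρ') (hfin _ hρ.2) hC'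

/-! ### The superlevel sets of the Schwarz symmetral -/

theorem mem_schwarzSet_iff {n : ℕ} {A : Set (EuclideanSpace ℝ (Fin n))}
    {x : EuclideanSpace ℝ (Fin n)} :
    x ∈ schwarzSet A ↔ volume A ≠ 0 ∧ ‖x‖ ≤ ballRadius n (volume A) := by
  simp [schwarzSet, ballRadius]

theorem ballRadius_zero {n : ℕ} (hn : 1 ≤ n) : ballRadius n 0 = 0 := by
  have : (1 / (n : ℝ)) ≠ 0 := by positivity
  rw [ballRadius, ENNReal.toReal_zero, zero_div, Real.zero_rpow this]

theorem tendsto_ballRadius {n : ℕ} {u : ℕ → ℝ≥0∞} {V : ℝ≥0∞} (hV : V ≠ ∞)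
    (h : Filter.Tendsto u Filter.atTop (nhds V)) :
    Filter.Tendsto (fun k => ballRadius n (u k)) Filter.atTop (nhds (ballRadius n V)) :=
  (((ENNReal.tendsto_toReal hV).comp h).div_const _).rpow_const (Or.inr (by positivity))

theorem antitone_volume_superlevel {n : ℕ} (h : EuclideanSpace ℝ (Fin n) → ℝ) :
    Antitone fun t : ℝ => volume {y | t ≤ h y} := fun _ _ hst =>
  measure_mono fun _ hy => hst.trans hy

theorem lintegral_schwarzSet_indicator {n : ℕ} (h : EuclideanSpace ℝ (Fin n) → ℝ)
    (x : EuclideanSpace ℝ (Fin n)) :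
    ∫⁻ t in Ioi (0 : ℝ), (schwarzSet {y | t ≤ |h y|}).indicator (fun _ => (1 : ℝ≥0∞)) x =
      volume {t : ℝ | 0 < t ∧ x ∈ schwarzSet {y | t ≤ |h y|}} := by
  have hV := (antitone_volume_superlevel fun y => |h y|).measurable
  have hr : Measurable fun t : ℝ => ballRadius n (volume {y | t ≤ |h y|}) :=
    (hV.ennreal_toReal.div_const _).pow_const _
  have hT : MeasurableSet {t : ℝ | x ∈ schwarzSet {y | t ≤ |h y|}} := by
    simp only [mem_schwarzSet_iff]
    exact (measurableSet_eq_fun hV measurable_const).compl.inter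
      (measurableSet_le measurable_const hr)
  have e : ∀ t : ℝ, (schwarzSet {y | t ≤ |h y|}).indicator (fun _ => (1 : ℝ≥0∞)) x =
      {t : ℝ | x ∈ schwarzSet {y | t ≤ |h y|}}.indicator 1 t := fun t => by
    by_cases hx : x ∈ schwarzSet {y | t ≤ |h y|}
    · rw [indicator_of_mem hx, indicator_of_mem (by exact hx), Pi.one_apply]
    · rw [indicator_of_notMem hx, indicator_of_notMem (by exact hx)]
  rw [lintegral_congr e, lintegral_indicator_one hT, Measure.restrict_apply hT, inter_comm]
  rfl

theorem measurable_schwarzSymm {n : ℕ} (h : EuclideanSpace ℝ (Fin n) → ℝ) :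
    Measurable (schwarzSymm h) := by
  have hV := (antitone_volume_superlevel fun y => |h y|).measurable
  have hr : Measurable fun t : ℝ => ballRadius n (volume {y | t ≤ |h y|}) :=
    (hV.ennreal_toReal.div_const _).pow_const _
  have hT : MeasurableSet {q : EuclideanSpace ℝ (Fin n) × ℝ |
      0 < q.2 ∧ q.1 ∈ schwarzSet {y | q.2 ≤ |h y|}} := by
    simp only [mem_schwarzSet_iff]
    exact (measurableSet_lt measurable_const measurable_snd).inter
      ((measurableSet_eq_fun (hV.comp measurable_snd) measurable_const).compl.inter
        (measurableSet_le measurable_fst.norm (hr.comp measurable_snd)))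
  unfold schwarzSymm
  simp_rw [lintegral_schwarzSet_indicator]
  exact (measurable_measure_prodMk_left hT).ennreal_toReal

theorem schwarzSymm_nonneg {n : ℕ} (h : EuclideanSpace ℝ (Fin n) → ℝ)
    (x : EuclideanSpace ℝ (Fin n)) : 0 ≤ schwarzSymm h x := ENNReal.toReal_nonneg

/-- The Schwarz symmetral depends only on the class of `|f|` modulo null sets. -/
theorem schwarzSymm_congr {n : ℕ} {f h : EuclideanSpace ℝ (Fin n) → ℝ}
    (hfh : ∀ᵐ x, |f x| = |h x|) : schwarzSymm f = schwarzSymm h := by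
  have e : ∀ t : ℝ, volume {y | t ≤ |f y|} = volume {y | t ≤ |h y|} := fun t =>
    measure_congr (hfh.mono fun y hy => by
      change (t ≤ |f y|) = (t ≤ |h y|)
      rw [hy])
  unfold schwarzSymm schwarzSet
  simp_rw [e]

theorem exists_ballRadius_superlevel_lt {n : ℕ} (hn : 1 ≤ n) {h : EuclideanSpace ℝ (Fin n) → ℝ}
    (hm : Measurable h) (hfin : ∀ t : ℝ, 0 < t → volume {y | t ≤ h y} ≠ ∞) {ε : ℝ} (hε : 0 < ε) :
    ∃ k : ℕ, ballRadius n (volume {y | (k : ℝ) + 1 ≤ h y}) < ε := by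
  have hlim := tendsto_measure_iInter_atTop (μ := volume)
    (s := fun k : ℕ => {y | (k : ℝ) + 1 ≤ h y})
    (fun k => (measurableSet_le measurable_const hm).nullMeasurableSet)
    (fun i j hij y hy => le_trans (by have : (i : ℝ) ≤ j := by exact_mod_cast hij
                                      change (i : ℝ) + 1 ≤ j + 1; linarith) hy)
    ⟨0, hfin _ (by positivity)⟩
  have he : ⋂ k : ℕ, {y | (k : ℝ) + 1 ≤ h y} = ∅ := by
    ext y
    simp only [mem_iInter, mem_ofPred_eq, mem_empty_iff_false, iff_false, not_forall, not_le]
    obtain ⟨k, hk⟩ := exists_nat_gt (h y)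
    exact ⟨k, by linarith⟩
  rw [he, measure_empty] at hlim
  have := tendsto_ballRadius (n := n) ENNReal.zero_ne_top hlim
  rw [ballRadius_zero hn] at this
  exact (this.eventually_lt_const hε).exists

/-- At `x ≠ 0` the levels `t` whose ball contains `x` form an interval with left end point `0`, and
the value of the symmetral is its length. -/
theorem lt_schwarzSymm_iff {n : ℕ} (hn : 1 ≤ n) {h : EuclideanSpace ℝ (Fin n) → ℝ}
    (hm : Measurable h) (h0 : ∀ x, 0 ≤ h x) (hfin : ∀ t : ℝ, 0 < t → volume {y | t ≤ h y} ≠ ∞)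
    {x : EuclideanSpace ℝ (Fin n)} (hx : x ≠ 0) {τ : ℝ} (hτ : 0 < τ) :
    τ < schwarzSymm h x ↔ ∃ t, τ < t ∧ volume {y | t ≤ h y} ≠ 0 ∧
      ‖x‖ ≤ ballRadius n (volume {y | t ≤ h y}) := by
  have habs : ∀ y, |h y| = h y := fun y => abs_of_nonneg (h0 y)
  rw [schwarzSymm, lintegral_schwarzSet_indicator]
  simp only [habs, mem_schwarzSet_iff]
  set T := {t : ℝ | 0 < t ∧ volume {y | t ≤ h y} ≠ 0 ∧
    ‖x‖ ≤ ballRadius n (volume {y | t ≤ h y})} with hT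
  have hlow : ∀ t ∈ T, Ioc 0 t ⊆ T := by
    rintro t ⟨ht0, ht1, ht2⟩ t' ⟨h1, h2⟩
    have hle := antitone_volume_superlevel h h2
    exact ⟨h1, fun hz => ht1 (le_antisymm (hz ▸ hle) zero_le),
      ht2.trans (ballRadius_mono n hle (hfin _ h1))⟩
  have hTfin : volume T ≠ ∞ := by
    obtain ⟨k, hk⟩ := exists_ballRadius_superlevel_lt hn hm hfin (norm_pos_iff.2 hx)
    have : T ⊆ Ioc 0 ((k : ℝ) + 1) := by
      rintro t ⟨ht0, ht1, ht2⟩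
      refine ⟨ht0, ?_⟩
      by_contra! hlt
      have := ballRadius_mono n (antitone_volume_superlevel h hlt.le) (hfin _ (by positivity))
      exact absurd (ht2.trans this) (not_le.2 hk)
    exact ((measure_mono this).trans_lt (by simp)).ne
  constructor
  · intro hlt
    by_contra! hcon
    have : T ⊆ Ioc 0 τ := by
      rintro t ⟨ht0, ht1, ht2⟩
      refine ⟨ht0, ?_⟩
      by_contra! h'
      exact absurd ht2 (not_le.2 (hcon t h' ht1))
    have h2 := ENNReal.toReal_mono (by simp) (measure_mono (μ := volume) this)
    rw [Real.volume_Ioc, sub_zero, ENNReal.toReal_ofReal hτ.le] at h2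
    linarith
  · rintro ⟨t, h1, h2, h3⟩
    have ht : t ∈ T := ⟨hτ.trans h1, h2, h3⟩
    have h4 := ENNReal.toReal_mono hTfin (measure_mono (μ := volume) (hlow t ht))
    rw [Real.volume_Ioc, sub_zero, ENNReal.toReal_ofReal (hτ.trans h1).le] at h4
    linarith

theorem isBallRearrangement_schwarzSymm {n : ℕ} (hn : 1 ≤ n) {h : EuclideanSpace ℝ (Fin n) → ℝ}
    (hm : Measurable h) (h0 : ∀ x, 0 ≤ h x) (hfin : ∀ t : ℝ, 0 < t → volume {y | t ≤ h y} ≠ ∞) :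
    IsBallRearrangement h (schwarzSymm h) := by
  intro τ hτ
  have : Nonempty (Fin n) := ⟨⟨0, hn⟩⟩
  set r := ballRadius n (volume {x | τ < h x}) with hr
  have hτfin : volume {x | τ < h x} ≠ ∞ :=
    ((measure_mono fun x (hx : τ < h x) => hx.le).trans_lt (hfin τ hτ).lt_top).ne
  have h1 : ∀ᵐ x : EuclideanSpace ℝ (Fin n), x ≠ 0 :=
    compl_mem_ae_iff.2 (measure_singleton _)
  have h2 : ∀ᵐ x : EuclideanSpace ℝ (Fin n), x ∉ sphere 0 r :=
    compl_mem_ae_iff.2 (Measure.addHaar_sphere _ _ _)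
  filter_upwards [h1, h2] with x hx0 hxs
  rw [mem_sphere_zero_iff_norm] at hxs
  refine propext ?_
  change τ < schwarzSymm h x ↔ x ∈ ball 0 r
  rw [lt_schwarzSymm_iff hn hm h0 hfin hx0 hτ, mem_ball_zero_iff]
  constructor
  · rintro ⟨t, ht, -, h3⟩
    exact lt_of_le_of_ne (h3.trans (ballRadius_mono n
      (measure_mono fun y (hy : t ≤ h y) => ht.trans_le hy) hτfin)) hxs
  · intro hlt
    have hlim := tendsto_measure_iUnion_atTop (μ := volume)
      (s := fun k : ℕ => {y | τ + 1 / ((k : ℝ) + 1) ≤ h y})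
      (fun i j hij y hy => le_trans (add_le_add_right (one_div_le_one_div_of_le (by positivity)
        (by have : (i : ℝ) ≤ j := by exact_mod_cast hij
            linarith)) τ) hy)
    have he : ⋃ k : ℕ, {y | τ + 1 / ((k : ℝ) + 1) ≤ h y} = {y | τ < h y} := by
      ext y
      simp only [mem_iUnion, mem_ofPred_eq]
      constructor
      · rintro ⟨k, hk⟩
        have : 0 < 1 / ((k : ℝ) + 1) := by positivity
        linarith
      · intro hy
        obtain ⟨k, hk⟩ := exists_nat_one_div_lt (sub_pos.2 hy)
        exact ⟨k, by linarith⟩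
    rw [he] at hlim
    obtain ⟨k, hk⟩ := ((tendsto_ballRadius (n := n) hτfin hlim).eventually_const_lt hlt).exists
    refine ⟨τ + 1 / ((k : ℝ) + 1), by have : 0 < 1 / ((k : ℝ) + 1) := by positivity
                                      linarith, fun hz => ?_, hk.le⟩
    simp only [Function.comp_apply] at hk
    rw [hz, ballRadius_zero hn] at hk
    exact absurd hk (not_lt.2 (norm_nonneg x))

/-! ### Lower bounds for powers of the translation energy -/

/-- The hypothesis is used for the part `D` of `C` where `φ < b`: there `φ ^ α ≥ b ^ (α - 1) * φ`,
and elsewhere `φ ^ α ≥ b ^ α`. -/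
theorem mul_sub_le_lintegral_rpow_of_le_one {X : Type*} [MeasurableSpace X] {μ : Measure X}
    {C : Set X} {φ : X → ℝ≥0∞} (hφ : Measurable φ) {M₀ b : ℝ≥0∞} (hb : b ≠ ∞)
    {α : ℝ} (hα0 : 0 < α) (hα : α ≤ 1)
    (h : ∀ D ⊆ C, (∃ S, MeasurableSet S ∧ D = C ∩ S) → b * (μ D - M₀) ≤ ∫⁻ x in D, φ x ∂μ) :
    b ^ α * (μ C - M₀) ≤ ∫⁻ x in C, φ x ^ α ∂μ := by
  rcases eq_or_ne b 0 with rfl | hb0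
  · simp [ENNReal.zero_rpow_of_pos hα0]
  have hS : MeasurableSet {x | φ x < b} := measurableSet_lt hφ measurable_const
  have h1 := h (C ∩ {x | φ x < b}) inter_subset_left ⟨_, hS, rfl⟩
  have hlow : b ^ α * (μ (C ∩ {x | φ x < b}) - M₀) ≤
      ∫⁻ x in C ∩ {x | φ x < b}, φ x ^ α ∂μ := by
    have h2 : ∫⁻ x in C ∩ {x | φ x < b}, φ x ∂μ ≤
        b ^ (1 - α) * ∫⁻ x in C ∩ {x | φ x < b}, φ x ^ α ∂μ := by
      rw [← lintegral_const_mul _ (hφ.pow_const α)]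
      refine lintegral_mono_ae ?_
      have : ∀ᵐ x ∂(μ.restrict (C ∩ {x | φ x < b})), φ x < b := by
        rw [inter_comm, ← Measure.restrict_restrict hS]
        exact ae_restrict_mem hS
      filter_upwards [this] with x hx
      calc φ x = φ x ^ (1 - α) * φ x ^ α := by
            rw [← ENNReal.rpow_add_of_nonneg _ _ (by linarith) hα0.le, sub_add_cancel,
              ENNReal.rpow_one]
        _ ≤ b ^ (1 - α) * φ x ^ α := by
            gcongr
    have hbne : b ^ (1 - α) ≠ 0 := (ENNReal.rpow_pos (pos_iff_ne_zero.2 hb0) hb).ne'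
    have hbtop : b ^ (1 - α) ≠ ∞ := ENNReal.rpow_ne_top_of_nonneg (by linarith) hb
    refine (ENNReal.mul_le_mul_iff_right hbne hbtop).1 (le_trans (le_of_eq ?_) (h1.trans h2))
    rw [← mul_assoc, ← ENNReal.rpow_add_of_nonneg _ _ (by linarith) hα0.le, sub_add_cancel,
      ENNReal.rpow_one]
  have hhigh : b ^ α * μ (C \ {x | φ x < b}) ≤ ∫⁻ x in C \ {x | φ x < b}, φ x ^ α ∂μ := by
    rw [← setLIntegral_const]
    refine lintegral_mono_ae ?_
    have : ∀ᵐ x ∂(μ.restrict (C \ {x | φ x < b})), x ∈ {x | φ x < b}ᶜ := by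
      rw [Set.sdiff_eq, inter_comm, ← Measure.restrict_restrict hS.compl]
      exact ae_restrict_mem hS.compl
    filter_upwards [this] with x hx
    exact ENNReal.rpow_le_rpow (not_lt.1 hx) hα0.le
  calc b ^ α * (μ C - M₀)
      ≤ b ^ α * ((μ (C ∩ {x | φ x < b}) - M₀) + μ (C \ {x | φ x < b})) := by
        gcongr
        rw [← measure_inter_add_sdiff C hS, tsub_le_iff_right, add_right_comm]
        gcongr
        exact le_tsub_add
    _ ≤ _ := by
        rw [mul_add, ← lintegral_inter_add_sdiff _ C hS]
        exact add_le_add hlow hhigh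

/-- A form of Jensen's inequality, obtained from Hölder's. -/
theorem mul_rpow_le_lintegral_rpow_of_one_lt {X : Type*} [MeasurableSpace X] {μ : Measure X}
    {C : Set X} {φ : X → ℝ≥0∞} (hφ : Measurable φ) {b δ : ℝ≥0∞} (hC : μ C ≠ ∞)
    {α : ℝ} (hα : 1 < α) (h : b * (δ * μ C) ≤ ∫⁻ x in C, φ x ∂μ) :
    b ^ α * (δ ^ α * μ C) ≤ ∫⁻ x in C, φ x ^ α ∂μ := by
  rcases eq_or_ne (μ C) 0 with hC0 | hC0
  · simp [hC0]
  have hα0 : 0 < α := by linarith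
  have hpq : α.HolderConjugate (α / (α - 1)) := Real.HolderConjugate.conjExponent hα
  have hH := ENNReal.lintegral_mul_le_Lp_mul_Lq (μ.restrict C) hpq hφ.aemeasurable
    (aemeasurable_const (b := (1 : ℝ≥0∞)))
  simp only [Pi.mul_apply, mul_one, ENNReal.one_rpow, lintegral_const, one_mul,
    Measure.restrict_apply_univ] at hH
  have h1 := ENNReal.rpow_le_rpow (h.trans hH) hα0.le
  have hM : μ C ^ (α - 1) ≠ 0 := (ENNReal.rpow_pos (pos_iff_ne_zero.2 hC0) hC).ne'
  have hM' : μ C ^ (α - 1) ≠ ∞ := ENNReal.rpow_ne_top_of_nonneg (by linarith) hC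
  refine (ENNReal.mul_le_mul_iff_right hM hM').1 ?_
  calc _ = (b * (δ * μ C)) ^ α := by
        rw [ENNReal.mul_rpow_of_nonneg _ _ hα0.le, ENNReal.mul_rpow_of_nonneg _ _ hα0.le]
        have : μ C ^ α = μ C ^ (α - 1) * μ C := by
          nth_rw 3 [← ENNReal.rpow_one (μ C)]
          rw [← ENNReal.rpow_add_of_nonneg _ _ (by linarith) zero_le_one, sub_add_cancel]
        rw [this]
        ring
    _ ≤ _ := h1
    _ = _ := by
        rw [ENNReal.mul_rpow_of_nonneg _ _ hα0.le, ← ENNReal.rpow_mul, ← ENNReal.rpow_mul,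
          one_div_mul_cancel hα0.ne', ENNReal.rpow_one, mul_comm]
        congr 2
        have : α - 1 ≠ 0 := by linarith
        field_simp

/-- If the integral of `φ` over each part `D` of `C` is at least `a (|D| - |C| / 2)`, then the
`α`-th power of `φ` has integral at least `2^{-max(α, 1)} a^α |C|` over `C`. -/
theorem mul_le_lintegral_rpow {X : Type*} [MeasurableSpace X] {μ : Measure X}
    {C : Set X} {φ : X → ℝ≥0∞} (hφ : Measurable φ) {a : ℝ≥0∞} (hC : μ C ≠ ∞)
    {α : ℝ} (hα0 : 0 < α)
    (h : ∀ D ⊆ C, (∃ S, MeasurableSet S ∧ D = C ∩ S) → a * (μ D - μ C / 2) ≤ ∫⁻ x in D, φ x ∂μ) :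
    a ^ α * ((2⁻¹ : ℝ≥0∞) ^ max α 1 * μ C) ≤ ∫⁻ x in C, φ x ^ α ∂μ := by
  have half : μ C - μ C / 2 = 2⁻¹ * μ C := by
    rw [ENNReal.sub_half hC, ENNReal.div_eq_inv_mul]
  refine ENNReal.mul_le_of_forall_lt fun a' ha' d hd => ?_
  set b := a' ^ (1 / α) with hb
  have hba : b ≤ a := by
    have := ENNReal.rpow_le_rpow ha'.le (show 0 ≤ 1 / α by positivity)
    rwa [← ENNReal.rpow_mul, mul_one_div_cancel hα0.ne', ENNReal.rpow_one] at this
  have hbtop : b ≠ ∞ := ENNReal.rpow_ne_top_of_nonneg (by positivity) ha'.ne_top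
  have hbα : b ^ α = a' := by
    rw [hb, ← ENNReal.rpow_mul, one_div_mul_cancel hα0.ne', ENNReal.rpow_one]
  rw [← hbα]
  refine le_trans (mul_le_mul_right hd.le _) ?_
  rcases le_or_gt α 1 with hα | hα
  · rw [max_eq_right hα, ENNReal.rpow_one, ← half]
    exact mul_sub_le_lintegral_rpow_of_le_one hφ hbtop hα0 hα fun D hD hS =>
      le_trans (by gcongr) (h D hD hS)
  · rw [max_eq_left hα.le]
    refine mul_rpow_le_lintegral_rpow_of_one_lt hφ hC hα ?_
    rw [← half]
    exact le_trans (by gcongr) (h C subset_rfl ⟨univ, MeasurableSet.univ, by simp⟩)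

theorem setLIntegral_comp_smul {n : ℕ} {t : ℝ} (ht : 0 < t) (φ : EuclideanSpace ℝ (Fin n) → ℝ≥0∞)
    (C : Set (EuclideanSpace ℝ (Fin n))) :
    ∫⁻ ξ in C, φ (t • ξ) = ENNReal.ofReal ((t ^ n)⁻¹) * ∫⁻ ξ in t • C, φ ξ := by
  have hemb : MeasurableEmbedding fun ξ : EuclideanSpace ℝ (Fin n) => t • ξ :=
    (Homeomorph.smulOfNeZero t ht.ne').measurableEmbedding
  have hpre : (fun ξ : EuclideanSpace ℝ (Fin n) => t • ξ) ⁻¹' (t • C) = C := by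
    ext ξ
    exact smul_mem_smul_set_iff₀ ht.ne' C ξ
  have h1 := hemb.lintegral_map (μ := volume.restrict C) φ
  rw [← h1]
  nth_rw 1 [← hpre]
  rw [← hemb.restrict_map, Measure.map_addHaar_smul _ ht.ne', finrank_euclideanSpace_fin,
    Measure.restrict_smul, lintegral_smul_measure, abs_of_pos (by positivity)]
  rfl

theorem ballRadius_smul {n : ℕ} (hn : 1 ≤ n) {t : ℝ} (ht : 0 < t)
    (C : Set (EuclideanSpace ℝ (Fin n))) :
    ballRadius n (volume (t • C)) = t * ballRadius n (volume C) := by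
  rw [Measure.addHaar_smul, finrank_euclideanSpace_fin, ballRadius, ENNReal.toReal_mul,
    abs_of_pos (by positivity), ENNReal.toReal_ofReal (by positivity), mul_div_assoc,
    Real.mul_rpow (by positivity) (by positivity), ← Real.rpow_natCast, ← Real.rpow_mul ht.le,
    mul_one_div_cancel (by positivity), Real.rpow_one]
  rfl

/-- The rearrangement inequality for translation energies, for shifts scaled by `t`. -/
theorem IsBallRearrangement.lintegral_translateEnergy_smul_le {n : ℕ} (hn : 1 ≤ n) {p : ℝ}
    (hp : 1 ≤ p) {f g : EuclideanSpace ℝ (Fin n) → ℝ} (hf : Measurable f) (hf0 : ∀ x, 0 ≤ f x)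
    (hfin : ∀ τ : ℝ, 0 < τ → volume {x | τ < f x} ≠ ∞)
    (hg : Measurable g) (hg0 : ∀ x, 0 ≤ g x) (h : IsBallRearrangement f g)
    {C : Set (EuclideanSpace ℝ (Fin n))} (hC : MeasurableSet C) (hC' : volume C ≠ ∞)
    {t : ℝ} (ht : 0 < t) :
    ∫⁻ ξ in ball 0 (ballRadius n (volume C)), translateEnergy p g (t • ξ) ≤
      ∫⁻ ξ in C, translateEnergy p f (t • ξ) := by
  rw [setLIntegral_comp_smul ht, setLIntegral_comp_smul ht, _root_.smul_ball ht.ne', smul_zero,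
    Real.norm_of_nonneg ht.le, ← ballRadius_smul hn ht]
  refine mul_le_mul_right ?_ _
  refine h.lintegral_translateEnergy_le hn hp hf hf0 hfin hg hg0 (hC.const_smul₀ t) ?_
  rw [Measure.addHaar_smul]
  finiteness

theorem volume_ball_half_le {n : ℕ} (hn : 1 ≤ n) {r : ℝ} (hr : 0 ≤ r) :
    volume (ball (0 : EuclideanSpace ℝ (Fin n)) (r / 2)) ≤
      volume (ball (0 : EuclideanSpace ℝ (Fin n)) r) / 2 := by
  have : Nonempty (Fin n) := ⟨⟨0, hn⟩⟩
  rw [Measure.addHaar_ball _ _ (by positivity), Measure.addHaar_ball _ _ hr,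
    finrank_euclideanSpace_fin, div_pow, ENNReal.ofReal_div_of_pos (by positivity),
    ENNReal.div_eq_inv_mul, ENNReal.div_eq_inv_mul, mul_assoc]
  gcongr
  rw [← ENNReal.ofReal_ofNat 2]
  refine ENNReal.ofReal_le_ofReal ?_
  calc (2 : ℝ) = 2 ^ 1 := by norm_num
    _ ≤ 2 ^ n := pow_le_pow_right₀ (by norm_num) hn

/-- Comparison of the energy of the rearrangement at one shift `η` with the energies of `f` at the
shifts in `C`. Outside of the ball of half the radius of `C⋆`, the energy of the rearrangement is at
least its value at `η`, and that ball has at most half of the measure of `C`. -/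
theorem IsBallRearrangement.rpow_mul_le_lintegral {n : ℕ} (hn : 1 ≤ n) {p α : ℝ}
    (hp : 1 ≤ p) (hα : 0 < α) {f g : EuclideanSpace ℝ (Fin n) → ℝ} (hf : Measurable f)
    (hf0 : ∀ x, 0 ≤ f x) (hfin : ∀ τ : ℝ, 0 < τ → volume {x | τ < f x} ≠ ∞)
    (hg : Measurable g) (hg0 : ∀ x, 0 ≤ g x) (h : IsBallRearrangement f g)
    {C : Set (EuclideanSpace ℝ (Fin n))} (hC : MeasurableSet C) (hC' : volume C ≠ ∞)
    {t : ℝ} (ht : 0 < t) {η : EuclideanSpace ℝ (Fin n)}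
    (hη : ‖η‖ ≤ ballRadius n (volume C) / 2) :
    translateEnergy p g (t • η) ^ α * ((2⁻¹ : ℝ≥0∞) ^ max α 1 * volume C) ≤
      ∫⁻ ξ in C, translateEnergy p f (t • ξ) ^ α := by
  have hm : Measurable fun ξ : EuclideanSpace ℝ (Fin n) => translateEnergy p f (t • ξ) :=
    (measurable_translateEnergy hf).comp (measurable_const_smul t)
  refine mul_le_lintegral_rpow hm hC' hα ?_
  rintro D hDC ⟨S, hS, rfl⟩
  have hDfin : volume (C ∩ S) ≠ ∞ := ((measure_mono hDC).trans_lt hC'.lt_top).ne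
  refine le_trans ?_ (h.lintegral_translateEnergy_smul_le hn hp hf hf0 hfin hg hg0
    (hC.inter hS) hDfin ht)
  set r := ballRadius n (volume C)
  set r' := ballRadius n (volume (C ∩ S))
  calc _ ≤ translateEnergy p g (t • η) *
        (volume (ball (0 : EuclideanSpace ℝ (Fin n)) r' \ ball 0 (r / 2))) := by
        gcongr
        refine le_trans ?_ le_measure_sdiff
        rw [volume_ball_ballRadius hn hDfin]
        refine tsub_le_tsub_left ?_ _
        conv_rhs => rw [← volume_ball_ballRadius hn hC']
        exact volume_ball_half_le hn (ballRadius_nonneg _ _)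
    _ = ∫⁻ _ in ball (0 : EuclideanSpace ℝ (Fin n)) r' \ ball 0 (r / 2),
        translateEnergy p g (t • η) := by rw [setLIntegral_const]
    _ ≤ ∫⁻ ξ in ball (0 : EuclideanSpace ℝ (Fin n)) r' \ ball 0 (r / 2),
        translateEnergy p g (t • ξ) := by
        refine setLIntegral_mono' (measurableSet_ball.diff measurableSet_ball) fun ξ hξ => ?_
        refine h.translateEnergy_mono hp hg hg0 ?_
        have : r / 2 ≤ ‖ξ‖ := by simpa using hξ.2
        rw [norm_smul, norm_smul]
        gcongr
        exact hη.trans this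
    _ ≤ _ := lintegral_mono_set sdiff_subset

/-! ### Besov polar projection bodies -/

/-- The power `s q` of the gauge function of the Besov polar projection body. -/
noncomputable def besovIntegral {n : ℕ} (s p q : ℝ) (f : EuclideanSpace ℝ (Fin n) → ℝ)
    (ξ : EuclideanSpace ℝ (Fin n)) : ℝ≥0∞ :=
  ∫⁻ t in Ioi (0 : ℝ), ENNReal.ofReal (t ^ (-(s * q))) * translateEnergy p f (t • ξ) ^ (q / p) *
    ENNReal.ofReal t⁻¹

theorem besovGauge_eq {n : ℕ} {s p q : ℝ} (hp : 1 ≤ p) (f : EuclideanSpace ℝ (Fin n) → ℝ)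
    (ξ : EuclideanSpace ℝ (Fin n)) :
    besovGauge s p q f ξ = besovIntegral s p q f ξ ^ (1 / (s * q)) := by
  have hp0 : 0 < p := by linarith
  rw [besovGauge, besovIntegral]
  congr 1
  refine lintegral_congr fun t => ?_
  rw [eLpNorm_eq_lintegral_rpow_enorm_toReal (by simpa using hp0) ENNReal.ofReal_ne_top,
    ENNReal.toReal_ofReal hp0.le, ← ENNReal.rpow_mul, one_div_mul_eq_div]
  rfl

theorem mem_besovBody_iff {n : ℕ} {s p q : ℝ} (hs : 0 < s) (hp : 1 ≤ p) (hq : 0 < q)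
    {f : EuclideanSpace ℝ (Fin n) → ℝ} {ξ : EuclideanSpace ℝ (Fin n)} :
    ξ ∈ besovBody s p q f ↔ besovIntegral s p q f ξ ≤ 1 := by
  have hsq : 0 < s * q := mul_pos hs hq
  change besovGauge s p q f ξ ≤ 1 ↔ _
  rw [besovGauge_eq hp]
  conv_lhs => rw [← ENNReal.one_rpow (1 / (s * q))]
  exact ENNReal.rpow_le_rpow_iff (by positivity)

theorem besovIntegral_smul {n : ℕ} {s p q : ℝ} (hs : 0 < s) (hp : 1 ≤ p) (hq : 0 < q)
    (f : EuclideanSpace ℝ (Fin n) → ℝ) (ξ : EuclideanSpace ℝ (Fin n)) {l : ℝ} (hl : 0 < l) :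
    besovIntegral s p q f (l • ξ) = ENNReal.ofReal (l ^ (s * q)) * besovIntegral s p q f ξ := by
  have hsq : 0 < s * q := mul_pos hs hq
  have h := besovGauge_smul (p := p) hs hq f ξ hl
  rw [besovGauge_eq hp, besovGauge_eq hp] at h
  have h2 : (besovIntegral s p q f (l • ξ) ^ (1 / (s * q))) ^ (s * q) =
    (ENNReal.ofReal l * besovIntegral s p q f ξ ^ (1 / (s * q))) ^ (s * q) := by rw [h]
  rwa [ENNReal.mul_rpow_of_nonneg _ _ hsq.le, ← ENNReal.rpow_mul, ← ENNReal.rpow_mul,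
    one_div_mul_cancel hsq.ne', ENNReal.rpow_one, ENNReal.rpow_one,
    ENNReal.ofReal_rpow_of_pos hl] at h2

theorem measurable_besovIntegrand {n : ℕ} {s p q : ℝ} {f : EuclideanSpace ℝ (Fin n) → ℝ}
    (hf : Measurable f) : Measurable fun w : EuclideanSpace ℝ (Fin n) × ℝ =>
      ENNReal.ofReal (w.2 ^ (-(s * q))) * translateEnergy p f (w.2 • w.1) ^ (q / p) *
        ENNReal.ofReal w.2⁻¹ := by
  have h1 : Measurable fun w : EuclideanSpace ℝ (Fin n) × ℝ => translateEnergy p f (w.2 • w.1) :=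
    (measurable_translateEnergy hf).comp (measurable_snd.smul measurable_fst)
  fun_prop

theorem measurable_besovIntegral {n : ℕ} {s p q : ℝ} {f : EuclideanSpace ℝ (Fin n) → ℝ}
    (hf : Measurable f) : Measurable (besovIntegral s p q f) :=
  (measurable_besovIntegrand hf).lintegral_prod_right'

theorem lintegral_besovIntegral {n : ℕ} {s p q : ℝ} {f : EuclideanSpace ℝ (Fin n) → ℝ}
    (hf : Measurable f) (C : Set (EuclideanSpace ℝ (Fin n))) :
    ∫⁻ ξ in C, besovIntegral s p q f ξ = ∫⁻ t in Ioi (0 : ℝ), ENNReal.ofReal (t ^ (-(s * q))) *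
      (∫⁻ ξ in C, translateEnergy p f (t • ξ) ^ (q / p)) * ENNReal.ofReal t⁻¹ := by
  unfold besovIntegral
  rw [lintegral_lintegral_swap (measurable_besovIntegrand hf).aemeasurable]
  refine lintegral_congr fun t => ?_
  rw [lintegral_mul_const' _ _ ENNReal.ofReal_ne_top,
    lintegral_const_mul' _ _ ENNReal.ofReal_ne_top]

theorem IsBallRearrangement.besovIntegral_mono {n : ℕ} {s p q : ℝ} (hp : 1 ≤ p) (hq : 0 < q)
    {f g : EuclideanSpace ℝ (Fin n) → ℝ} (hg : Measurable g) (hg0 : ∀ x, 0 ≤ g x)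
    (h : IsBallRearrangement f g) {ξ ξ' : EuclideanSpace ℝ (Fin n)} (hξ : ‖ξ‖ ≤ ‖ξ'‖) :
    besovIntegral s p q g ξ ≤ besovIntegral s p q g ξ' := by
  refine lintegral_mono fun t => ?_
  have : translateEnergy p g (t • ξ) ≤ translateEnergy p g (t • ξ') :=
    h.translateEnergy_mono hp hg hg0 (by rw [norm_smul, norm_smul]; gcongr)
  gcongr

/-- Bound on the gauge of the rearrangement at half the radius of the ball with the measure of a
subset `C` of the body of `f`. -/
theorem IsBallRearrangement.besovIntegral_le {n : ℕ} (hn : 1 ≤ n) {s p q : ℝ}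
    (hs : 0 < s) (hp : 1 ≤ p) (hq : 0 < q) {f g : EuclideanSpace ℝ (Fin n) → ℝ} (hf : Measurable f)
    (hf0 : ∀ x, 0 ≤ f x) (hfin : ∀ τ : ℝ, 0 < τ → volume {x | τ < f x} ≠ ∞)
    (hg : Measurable g) (hg0 : ∀ x, 0 ≤ g x) (h : IsBallRearrangement f g)
    {C : Set (EuclideanSpace ℝ (Fin n))} (hC : MeasurableSet C) (hC' : volume C ≠ ∞)
    (hC0 : volume C ≠ 0) (hCf : C ⊆ besovBody s p q f) {η : EuclideanSpace ℝ (Fin n)}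
    (hη : ‖η‖ ≤ ballRadius n (volume C) / 2) :
    besovIntegral s p q g η ≤ ENNReal.ofReal (2 ^ max (q / p) 1) := by
  have hα : 0 < q / p := div_pos hq (by linarith)
  set β := max (q / p) 1 with hβ
  have hβ0 : 0 < β := lt_max_of_lt_right one_pos
  have h2 : (2⁻¹ : ℝ≥0∞) ^ β ≠ ∞ := by finiteness
  have h1 : besovIntegral s p q g η * ((2⁻¹ : ℝ≥0∞) ^ β * volume C) ≤ volume C := by
    calc _ = ∫⁻ t in Ioi (0 : ℝ), ENNReal.ofReal (t ^ (-(s * q))) *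
          (translateEnergy p g (t • η) ^ (q / p) * ((2⁻¹ : ℝ≥0∞) ^ β * volume C)) *
          ENNReal.ofReal t⁻¹ := by
          rw [besovIntegral, ← lintegral_mul_const' _ _ (ENNReal.mul_ne_top h2 hC')]
          refine lintegral_congr fun t => ?_
          ring
      _ ≤ ∫⁻ ξ in C, besovIntegral s p q f ξ := by
          rw [lintegral_besovIntegral hf]
          refine setLIntegral_mono' measurableSet_Ioi fun t ht => ?_
          gcongr
          exact h.rpow_mul_le_lintegral hn hp hα hf hf0 hfin hg hg0 hC hC' ht hη
      _ ≤ ∫⁻ _ in C, 1 := setLIntegral_mono' hC fun ξ hξ =>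
          (mem_besovBody_iff hs hp hq).1 (hCf hξ)
      _ = volume C := by rw [setLIntegral_const, one_mul]
  rw [← mul_assoc] at h1
  have h3 : besovIntegral s p q g η * (2⁻¹ : ℝ≥0∞) ^ β ≤ 1 := by
    refine (ENNReal.mul_le_mul_iff_left hC0 hC').1 ?_
    rwa [one_mul]
  rw [ENNReal.inv_rpow, ← div_eq_mul_inv, ENNReal.div_le_iff (by simp) (by finiteness),
    one_mul] at h3
  rwa [← ENNReal.ofReal_rpow_of_pos two_pos, ENNReal.ofReal_ofNat]

theorem IsBallRearrangement.ball_subset_besovBody {n : ℕ} (hn : 1 ≤ n) {s p q : ℝ}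
    (hs : 0 < s) (hp : 1 ≤ p) (hq : 0 < q) {f g : EuclideanSpace ℝ (Fin n) → ℝ} (hf : Measurable f)
    (hf0 : ∀ x, 0 ≤ f x) (hfin : ∀ τ : ℝ, 0 < τ → volume {x | τ < f x} ≠ ∞)
    (hg : Measurable g) (hg0 : ∀ x, 0 ≤ g x) (h : IsBallRearrangement f g)
    {C : Set (EuclideanSpace ℝ (Fin n))} (hC : MeasurableSet C) (hC' : volume C ≠ ∞)
    (hCf : C ⊆ besovBody s p q f) :
    ball 0 ((2 : ℝ)⁻¹ * (2 ^ max (q / p) 1) ^ (-(1 / (s * q))) * ballRadius n (volume C)) ⊆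
      besovBody s p q g := by
  intro x hx
  have hsq : 0 < s * q := mul_pos hs hq
  set K : ℝ := 2 ^ max (q / p) 1 with hK
  have hK0 : 0 < K := by positivity
  set l : ℝ := K ^ (-(1 / (s * q))) with hl
  have hl0 : 0 < l := by positivity
  rw [mem_ball_zero_iff] at hx
  have hC0 : volume C ≠ 0 := by
    intro hz
    rw [hz, ballRadius_zero hn, mul_zero] at hx
    exact absurd hx (not_lt.2 (norm_nonneg x))
  have hη : ‖l⁻¹ • x‖ ≤ ballRadius n (volume C) / 2 := by
    rw [norm_smul, Real.norm_of_nonneg (by positivity), inv_mul_le_iff₀ hl0]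
    linarith
  rw [mem_besovBody_iff hs hp hq]
  have e : x = l • l⁻¹ • x := (smul_inv_smul₀ hl0.ne' x).symm
  rw [e, besovIntegral_smul hs hp hq _ _ hl0]
  calc _ ≤ ENNReal.ofReal (l ^ (s * q)) * ENNReal.ofReal K := by
        gcongr
        exact h.besovIntegral_le hn hs hp hq hf hf0 hfin hg hg0 hC hC' hC0 hCf hη
    _ = 1 := by
        rw [← ENNReal.ofReal_mul (by positivity), hl, ← Real.rpow_mul hK0.le, neg_mul,
          one_div_mul_cancel hsq.ne', Real.rpow_neg_one, inv_mul_cancel₀ hK0.ne',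
          ENNReal.ofReal_one]

/-- Among gauges that are at most `1` on a star-shaped set `C`, the gauge of `C` itself has the
largest integral of its power over `C`, and it has the distribution of `‖ξ‖ / r` on the ball of
radius `r` with the measure of `C`. -/
theorem lintegral_besovIntegral_le_of_starConvex {n : ℕ} (hn : 1 ≤ n) {s p q : ℝ}
    (hs : 0 < s) (hp : 1 ≤ p) (hq : 0 < q) {f : EuclideanSpace ℝ (Fin n) → ℝ} (hf : Measurable f)
    {C : Set (EuclideanSpace ℝ (Fin n))} (hC : MeasurableSet C) (hC' : volume C ≠ ∞)
    (hCs : StarConvex ℝ 0 C) (hCf : C ⊆ besovBody s p q f) :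
    ∫⁻ ξ in C, besovIntegral s p q f ξ ≤ ∫⁻ ξ in ball (0 : EuclideanSpace ℝ (Fin n))
      (ballRadius n (volume C)), ENNReal.ofReal ((‖ξ‖ / ballRadius n (volume C)) ^ (s * q)) := by
  have hsq : 0 < s * q := mul_pos hs hq
  set r := ballRadius n (volume C) with hr
  have hr0 : 0 ≤ r := ballRadius_nonneg _ _
  have : Nonempty (Fin n) := ⟨⟨0, hn⟩⟩
  have hle : ∀ ξ ∈ C, besovIntegral s p q f ξ ≤ 1 := fun ξ hξ =>
    (mem_besovBody_iff hs hp hq).1 (hCf hξ)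
  have hmeas := measurable_besovIntegral (s := s) (p := p) (q := q) hf
  have e1 : ∫⁻ ξ in C, besovIntegral s p q f ξ =
      ∫⁻ ξ in C, ENNReal.ofReal (besovIntegral s p q f ξ).toReal :=
    setLIntegral_congr_fun hC fun ξ hξ =>
      (ENNReal.ofReal_toReal (ne_top_of_le_ne_top ENNReal.one_ne_top (hle ξ hξ))).symm
  rw [e1, lintegral_eq_lintegral_meas_lt _ (Filter.Eventually.of_forall fun _ =>
      ENNReal.toReal_nonneg) hmeas.ennreal_toReal.aemeasurable,
    lintegral_eq_lintegral_meas_lt _ (Filter.Eventually.of_forall fun ξ => by positivity)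
      (by fun_prop)]
  refine setLIntegral_mono' measurableSet_Ioi fun τ (hτ : 0 < τ) => ?_
  rw [Measure.restrict_apply (measurableSet_lt measurable_const hmeas.ennreal_toReal),
    Measure.restrict_apply (measurableSet_lt measurable_const (by fun_prop))]
  rcases le_or_gt 1 τ with h1 | h1
  · have : {ξ | τ < (besovIntegral s p q f ξ).toReal} ∩ C = ∅ := by
      ext ξ
      simp only [mem_inter_iff, mem_ofPred_eq, mem_empty_iff_false, iff_false, not_and]
      intro hlt hξ
      have := ENNReal.toReal_mono ENNReal.one_ne_top (hle ξ hξ)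
      rw [ENNReal.toReal_one] at this
      linarith
    simp [this]
  set l := τ ^ (1 / (s * q)) with hl
  have hl0 : 0 < l := by positivity
  have hl1 : l ≤ 1 := Real.rpow_le_one hτ.le h1.le (by positivity)
  have hlτ : l ^ (s * q) = τ := by
    rw [hl, ← Real.rpow_mul hτ.le, one_div_mul_cancel hsq.ne', Real.rpow_one]
  have hlC : l • C ⊆ C := by
    rintro _ ⟨ξ, hξ, rfl⟩
    exact (starConvex_zero_iff.1 hCs) hξ hl0.le hl1
  have hlCfin : volume (l • C) ≠ ∞ := ((measure_mono hlC).trans_lt hC'.lt_top).ne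
  calc volume ({ξ | τ < (besovIntegral s p q f ξ).toReal} ∩ C)
      ≤ volume (C \ l • C) := by
        refine measure_mono ?_
        rintro ξ ⟨hξ, hξC⟩
        refine ⟨hξC, ?_⟩
        rintro ⟨ζ, hζ, rfl⟩
        simp only [mem_ofPred_eq] at hξ
        rw [besovIntegral_smul hs hp hq _ _ hl0, hlτ, ENNReal.toReal_mul,
          ENNReal.toReal_ofReal hτ.le] at hξ
        have := ENNReal.toReal_mono ENNReal.one_ne_top (hle ζ hζ)
        rw [ENNReal.toReal_one] at this
        nlinarith
    _ = volume (ball (0 : EuclideanSpace ℝ (Fin n)) r \ ball 0 (l * r)) := by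
        rw [measure_sdiff hlC (hC.const_smul₀ l).nullMeasurableSet hlCfin,
          measure_sdiff (ball_subset_ball (by nlinarith)) measurableSet_ball.nullMeasurableSet
            measure_ball_lt_top.ne, volume_ball_ballRadius hn hC', hr, ← ballRadius_smul hn hl0,
          volume_ball_ballRadius hn hlCfin]
    _ = volume (ball (0 : EuclideanSpace ℝ (Fin n)) r \ closedBall 0 (l * r)) := by
        refine measure_congr (Filter.EventuallyEq.rfl.diff ?_)
        rw [← ball_union_sphere]
        exact (union_ae_eq_left_of_ae_eq_empty
          (ae_eq_empty.2 (Measure.addHaar_sphere _ _ _))).symm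
    _ ≤ _ := by
        refine measure_mono ?_
        rintro ξ ⟨hξ, hξ'⟩
        refine ⟨?_, hξ⟩
        rw [mem_closedBall_zero_iff, not_le] at hξ'
        have hr' : 0 < r := pos_of_mem_ball hξ
        change τ < (‖ξ‖ / r) ^ (s * q)
        rw [← hlτ]
        exact Real.rpow_lt_rpow hl0.le ((lt_div_iff₀ hr').2 hξ') hsq

/-- For `p = q` the body of the rearrangement contains the ball with the measure of any star-shaped
subset `C` of finite measure of the body of `f`. -/
theorem IsBallRearrangement.ball_subset_besovBody_of_starConvex {n : ℕ} (hn : 1 ≤ n) {s p : ℝ}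
    (hs : 0 < s) (hp : 1 ≤ p) {f g : EuclideanSpace ℝ (Fin n) → ℝ} (hf : Measurable f)
    (hf0 : ∀ x, 0 ≤ f x) (hfin : ∀ τ : ℝ, 0 < τ → volume {x | τ < f x} ≠ ∞)
    (hg : Measurable g) (hg0 : ∀ x, 0 ≤ g x) (h : IsBallRearrangement f g)
    {C : Set (EuclideanSpace ℝ (Fin n))} (hC : MeasurableSet C) (hC' : volume C ≠ ∞)
    (hCs : StarConvex ℝ 0 C) (hCf : C ⊆ besovBody s p p f) :
    ball 0 (ballRadius n (volume C)) ⊆ besovBody s p p g := by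
  intro x hx
  have hp0 : 0 < p := by linarith
  have hsp : 0 < s * p := mul_pos hs hp0
  have : Nonempty (Fin n) := ⟨⟨0, hn⟩⟩
  set r := ballRadius n (volume C) with hr
  have hr0 : 0 < r := pos_of_mem_ball hx
  rw [mem_ball_zero_iff] at hx
  rcases eq_or_ne x 0 with rfl | hx0
  · change besovGauge s p p g 0 ≤ 1
    rw [besovGauge_zero hs hp0]
    exact zero_le_one
  have hx' : 0 < ‖x‖ := norm_pos_iff.2 hx0
  rw [mem_besovBody_iff hs hp hp0]
  set y := (r / ‖x‖) • x with hy
  have hny : ‖y‖ = r := by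
    rw [hy, norm_smul, Real.norm_of_nonneg (by positivity), div_mul_cancel₀ _ hx'.ne']
  refine (h.besovIntegral_mono hp hp0 hg hg0 (ξ' := y) (by rw [hny]; exact hx.le)).trans ?_
  set J := ∫⁻ ξ in ball (0 : EuclideanSpace ℝ (Fin n)) r, ENNReal.ofReal ((‖ξ‖ / r) ^ (s * p))
    with hJ
  have hJtop : J ≠ ∞ := by
    refine ne_top_of_le_ne_top (b := volume (ball (0 : EuclideanSpace ℝ (Fin n)) r))
      measure_ball_lt_top.ne ?_
    rw [hJ, ← one_mul (volume (ball (0 : EuclideanSpace ℝ (Fin n)) r)), ← setLIntegral_const]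
    refine setLIntegral_mono' measurableSet_ball fun ξ hξ => ?_
    rw [ENNReal.ofReal_le_one]
    rw [mem_ball_zero_iff] at hξ
    exact Real.rpow_le_one (by positivity) ((div_le_one hr0).2 hξ.le) hsp.le
  have hJ0 : J ≠ 0 := by
    intro hz
    rw [hJ, lintegral_eq_zero_iff (by fun_prop)] at hz
    have h1 : ∀ᵐ ξ ∂(volume.restrict (ball (0 : EuclideanSpace ℝ (Fin n)) r)), ξ ≠ 0 :=
      ae_restrict_of_ae (compl_mem_ae_iff.2 (measure_singleton _))
    have h2 : ∀ᵐ _ ∂(volume.restrict (ball (0 : EuclideanSpace ℝ (Fin n)) r)), False := by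
      filter_upwards [hz, h1] with ξ hξ hξ0
      have := norm_pos_iff.2 hξ0
      simp only [Pi.zero_apply, ENNReal.ofReal_eq_zero] at hξ
      exact absurd hξ (not_le.2 (by positivity))
    rw [Filter.eventually_false_iff_eq_bot, ae_eq_bot, Measure.restrict_eq_zero] at h2
    exact (measure_ball_pos volume _ hr0).ne' h2
  refine (ENNReal.mul_le_mul_iff_left hJ0 hJtop).1 ?_
  rw [one_mul]
  calc besovIntegral s p p g y * J
      = ∫⁻ ξ in ball (0 : EuclideanSpace ℝ (Fin n)) r,
          ENNReal.ofReal ((‖ξ‖ / r) ^ (s * p)) * besovIntegral s p p g y := by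
        rw [lintegral_mul_const _ (by fun_prop), mul_comm]
    _ ≤ ∫⁻ ξ in ball (0 : EuclideanSpace ℝ (Fin n)) r, besovIntegral s p p g ξ := by
        refine lintegral_mono fun ξ => ?_
        rcases eq_or_ne ξ 0 with rfl | hξ0
        · simp [Real.zero_rpow hsp.ne']
        · have := norm_pos_iff.2 hξ0
          rw [← besovIntegral_smul hs hp hp0 _ _ (by positivity)]
          refine h.besovIntegral_mono hp hp0 hg hg0 ?_
          rw [norm_smul, hny, Real.norm_of_nonneg (by positivity), div_mul_cancel₀ _ hr0.ne']
    _ ≤ ∫⁻ ξ in C, besovIntegral s p p f ξ := by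
        rw [lintegral_besovIntegral hg, lintegral_besovIntegral hf]
        refine setLIntegral_mono' measurableSet_Ioi fun t ht => ?_
        simp only [div_self hp0.ne', ENNReal.rpow_one]
        refine mul_le_mul_left (mul_le_mul_right ?_ _) _
        exact h.lintegral_translateEnergy_smul_le hn hp hf hf0 hfin hg hg0 hC hC' ht
    _ ≤ J := lintegral_besovIntegral_le_of_starConvex hn hs hp hp0 hf hC hC' hCs hCf

theorem ennreal_rpow_le_rpow_of_nonpos {x y : ℝ≥0∞} {z : ℝ} (hz : z ≤ 0) (h : x ≤ y) :
    y ^ z ≤ x ^ z := by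
  rw [← neg_neg z, ENNReal.rpow_neg y (-z), ENNReal.rpow_neg x (-z), ENNReal.inv_le_inv]
  exact ENNReal.rpow_le_rpow h (by linarith)

/-- If `L` contains the `l`-fold dilates of the balls with the measures of bounded parts of `K`,
then `|L| ≥ l^n |K|`; stated for the negative powers `-a / n`, with the conventions of `ℝ≥0∞`. -/
theorem volume_rpow_le_of_ball_subset {n : ℕ} (hn : 1 ≤ n) {K L : Set (EuclideanSpace ℝ (Fin n))}
    {l a : ℝ} (hl : 0 < l) (ha : 0 < a)
    (h : ∀ k : ℕ, ball 0 (l * ballRadius n (volume (K ∩ ball 0 (k : ℝ)))) ⊆ L) :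
    volume L ^ (-a / (n : ℝ)) ≤ ENNReal.ofReal (l ^ (-a)) * volume K ^ (-a / (n : ℝ)) := by
  have : Nonempty (Fin n) := ⟨⟨0, hn⟩⟩
  have hn0 : (0 : ℝ) < n := by positivity
  have hle : ENNReal.ofReal (l ^ n) * volume K ≤ volume L := by
    have h1 : Filter.Tendsto (fun k : ℕ => ENNReal.ofReal (l ^ n) * volume (K ∩ ball 0 (k : ℝ)))
        Filter.atTop (nhds (ENNReal.ofReal (l ^ n) * volume K)) := by
      refine ENNReal.Tendsto.const_mul ?_ (Or.inr ENNReal.ofReal_ne_top)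
      have := tendsto_measure_iUnion_atTop (μ := volume) (s := fun k : ℕ => K ∩ ball 0 (k : ℝ))
        (fun i j hij => inter_subset_inter_right _ (ball_subset_ball (by exact_mod_cast hij)))
      rwa [← inter_iUnion, iUnion_ball_nat, inter_univ] at this
    refine le_of_tendsto' h1 fun k => ?_
    have hfin : volume (K ∩ ball 0 (k : ℝ)) ≠ ∞ :=
      ((measure_mono inter_subset_right).trans_lt measure_ball_lt_top).ne
    refine le_trans (le_of_eq ?_) (measure_mono (h k))
    have e : ball (0 : EuclideanSpace ℝ (Fin n)) (l * ballRadius n (volume (K ∩ ball 0 (k : ℝ)))) =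
        l • ball 0 (ballRadius n (volume (K ∩ ball 0 (k : ℝ)))) := by
      rw [_root_.smul_ball hl.ne', smul_zero, Real.norm_of_nonneg hl.le]
    rw [e, Measure.addHaar_smul, finrank_euclideanSpace_fin, abs_of_pos (by positivity),
      volume_ball_ballRadius hn hfin]
  have hln : ENNReal.ofReal (l ^ n) ≠ 0 := by simpa using pow_pos hl n
  calc volume L ^ (-a / (n : ℝ)) ≤ (ENNReal.ofReal (l ^ n) * volume K) ^ (-a / (n : ℝ)) :=
        ennreal_rpow_le_rpow_of_nonpos (div_nonpos_of_nonpos_of_nonneg (by linarith) hn0.le) hle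
    _ = _ := by
        rcases eq_or_ne (volume K) ∞ with hK | hK
        · have : -a / (n : ℝ) < 0 := div_neg_of_neg_of_pos (by linarith) hn0
          rw [hK, ENNReal.mul_top hln, ENNReal.top_rpow_of_neg this, mul_zero]
        rw [ENNReal.mul_rpow_of_ne_top ENNReal.ofReal_ne_top hK,
          ENNReal.ofReal_rpow_of_pos (by positivity), ← Real.rpow_natCast, ← Real.rpow_mul hl.le,
          mul_div_cancel₀ _ hn0.ne']

/-- Replacing `f` by `|f|` enlarges the body. -/
theorem besovBody_subset_abs {n : ℕ} {s p q : ℝ} (hs : 0 < s) (hq : 0 < q)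
    {f h : EuclideanSpace ℝ (Fin n) → ℝ} (hfh : ∀ᵐ x, |f x| = h x) :
    besovBody s p q f ⊆ besovBody s p q h := by
  have hsq : 0 < s * q := mul_pos hs hq
  intro ξ hξ
  refine le_trans ?_ (show besovGauge s p q f ξ ≤ 1 from hξ)
  refine ENNReal.rpow_le_rpow (lintegral_mono fun t => ?_) (by positivity)
  have : eLpNorm (fun x => h (x + t • ξ) - h x) (ENNReal.ofReal p) volume ≤
      eLpNorm (fun x => f (x + t • ξ) - f x) (ENNReal.ofReal p) volume := by
    refine eLpNorm_mono_ae ?_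
    have h2 := (measurePreserving_add_right volume (t • ξ)).quasiMeasurePreserving.ae hfh
    filter_upwards [hfh, h2] with x hx1 hx2
    rw [← hx1, ← hx2]
    exact abs_abs_sub_abs_le_abs_sub _ _
  gcongr

theorem theorem3p9 {n : ℕ} (hn : 1 ≤ n) {s p q : ℝ} (hs0 : 0 < s) (hs1 : s < 1)
    (hp : 1 ≤ p) (hq : 1 ≤ q) (f : EuclideanSpace ℝ (Fin n) → ℝ)
    (hf : AEMeasurable f volume) (hfin : ∀ t : ℝ, 0 < t → volume {x | t ≤ |f x|} < ∞) :
    volume (besovBody s p q (schwarzSymm f)) ^ (-(s * q) / (n : ℝ)) ≤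
        ENNReal.ofReal ((4 : ℝ) ^ q * ((2 : ℝ) ^ n + 1) ^ max (q / p) 1) *
          volume (besovBody s p q f) ^ (-(s * q) / (n : ℝ)) ∧
      (p = q →
        volume (besovBody s p q (schwarzSymm f)) ^ (-(s * q) / (n : ℝ)) ≤
          volume (besovBody s p q f) ^ (-(s * q) / (n : ℝ))) := by
  have hq0 : 0 < q := by linarith
  have hsq : 0 < s * q := mul_pos hs0 hq0
  have hn0 : (0 : ℝ) < n := by positivity
  set h : EuclideanSpace ℝ (Fin n) → ℝ := fun x => |hf.mk f x| with hh
  have hm : Measurable h := hf.measurable_mk.abs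
  have h0 : ∀ x, 0 ≤ h x := fun x => abs_nonneg _
  have hfh : ∀ᵐ x, |f x| = h x := hf.ae_eq_mk.mono fun x hx => by rw [hx]
  have hfin' : ∀ t : ℝ, 0 < t → volume {x | t ≤ h x} ≠ ∞ := fun t ht => by
    have e : volume {x | t ≤ |f x|} = volume {x | t ≤ h x} :=
      measure_congr (hfh.mono fun x hx => by
        change (t ≤ |f x|) = (t ≤ h x)
        rw [hx])
    rw [← e]
    exact (hfin t ht).ne
  have hfin'' : ∀ t : ℝ, 0 < t → volume {x | t < h x} ≠ ∞ := fun t ht =>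
    ((measure_mono fun x (hx : t < h x) => hx.le).trans_lt (hfin' t ht).lt_top).ne
  have hsymm : schwarzSymm f = schwarzSymm h :=
    schwarzSymm_congr (hfh.mono fun x hx => by rw [hx, abs_of_nonneg (h0 x)])
  have hR : IsBallRearrangement h (schwarzSymm h) := isBallRearrangement_schwarzSymm hn hm h0 hfin'
  have hgm := measurable_schwarzSymm h
  have hg0 := schwarzSymm_nonneg h
  have hmono : volume (besovBody s p q h) ^ (-(s * q) / (n : ℝ)) ≤
      volume (besovBody s p q f) ^ (-(s * q) / (n : ℝ)) :=
    ennreal_rpow_le_rpow_of_nonpos (div_nonpos_of_nonpos_of_nonneg (by linarith) hn0.le)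
      (measure_mono (besovBody_subset_abs hs0 hq0 hfh))
  have hbody : MeasurableSet (besovBody s p q h) := by
    have e : besovBody s p q h = {ξ | besovIntegral s p q h ξ ≤ 1} := by
      ext ξ
      exact mem_besovBody_iff hs0 hp hq0
    rw [e]
    exact measurableSet_le (measurable_besovIntegral hm) measurable_const
  have hCm : ∀ k : ℕ, MeasurableSet (besovBody s p q h ∩ ball 0 (k : ℝ)) := fun k =>
    hbody.inter measurableSet_ball
  have hCfin : ∀ k : ℕ, volume (besovBody s p q h ∩ ball 0 (k : ℝ)) ≠ ∞ := fun k =>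
    ((measure_mono inter_subset_right).trans_lt measure_ball_lt_top).ne
  rw [hsymm]
  refine ⟨?_, ?_⟩
  · -- The constant obtained is `2^(sq) * 2^β` with `β = max (q / p) 1`.
    refine (volume_rpow_le_of_ball_subset hn (by positivity) hsq fun k =>
      hR.ball_subset_besovBody hn hs0 hp hq0 hm h0 hfin'' hgm hg0 (hCm k) (hCfin k)
        inter_subset_left).trans ?_
    refine mul_le_mul' (ENNReal.ofReal_le_ofReal ?_) hmono
    set β := max (q / p) 1 with hβ
    have hβ0 : 0 ≤ β := le_max_of_le_right zero_le_one
    rw [Real.mul_rpow (by positivity) (by positivity), ← Real.rpow_mul (by positivity), neg_mul_neg,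
      one_div_mul_cancel hsq.ne', Real.rpow_one, Real.inv_rpow two_pos.le, Real.rpow_neg two_pos.le,
      inv_inv]
    have h2n : (1 : ℝ) ≤ 2 ^ n := one_le_pow₀ one_le_two
    gcongr
    · calc (2 : ℝ) ^ (s * q) ≤ 2 ^ q := Real.rpow_le_rpow_of_exponent_le one_le_two (by nlinarith)
        _ ≤ 4 ^ q := Real.rpow_le_rpow two_pos.le (by norm_num) hq0.le
    · linarith
  · rintro rfl
    have hstar : ∀ k : ℕ, StarConvex ℝ 0 (besovBody s p p h ∩ ball 0 (k : ℝ)) := by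
      intro k
      rcases Nat.eq_zero_or_pos k with rfl | hk
      · simpa using starConvex_empty (𝕜 := ℝ) (0 : EuclideanSpace ℝ (Fin n))
      · exact (starConvex_besovBody hs0 hq0 h).inter
          ((convex_ball 0 (k : ℝ)).starConvex (mem_ball_self (by positivity)))
    refine le_trans ?_ hmono
    have := volume_rpow_le_of_ball_subset (L := besovBody s p p (schwarzSymm h)) hn one_pos hsq
      fun k => by
        rw [one_mul]
        exact hR.ball_subset_besovBody_of_starConvex hn hs0 hp hm h0 hfin'' hgm hg0 (hCm k)
          (hCfin k) (hstar k) inter_subset_left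
    simpa using this
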